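/- Let $(I,J)$ be a partial permutation of $[n]$ of size $k$: $I=(i_1,\dots,i_k)$ and $J=(j_1,\dots,j_k)$ are sequences of distinct elements of $[n]$. Its graph $G(I,J)$ is the directed graph on $[n]$ with edges $i_1\to j_1,\dots,i_k\to j_k$; each component is a directed path or a directed cycle. Let $\mu\vdash a$ be the path type of $(I,J)$ (the partition formed by the numbers of vertices of the path components) and let $\nu$ be its cycle type (the partition formed by the numbers of vertices of the cycle components). Let $$A_{n,I,J}:=n!\cdot \mathrm{ch}_n(R\,\mathbf 1_{I,J})$$ be the atomic symmetric function, where $\mathbf 1_{I,J}(w)=1$ if $w(i_p)=j_p$ for all $p$ and $\mathbf 1_{I,J}(w)=0$ otherwise, $(R f)(w)=\frac1{n!}\sum_{v\in\mathfrak S_n}f(v^{-1}wv)$, and $\mathrm{ch}_n(f)=\frac1{n!}\sum_{w\in\mathfrak S_n}f(w)\,p_{\mathrm{cyc}(w)}$ is the Frobenius characteristic, with $p_{\mathrm{cyc}(w)}$ the power sum indexed by the cycle type of $w$. Then $$A_{n,I,J}=m(\mu)!\cdot\sum_{\lambda\vdash n}\Big(\sum_{\rho\vdash a}\vec\chi^{\,\rho}_{\,\mu}\cdot\chi^{\lambda/\rho}_{\nu}\Big)\cdot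 s_\lambda ,$$ where $s_\lambda$ is the Schur function, $m(\mu)!=\prod_{i\ge1}m_i(\mu)!$ with $m_i(\mu)$ the multiplicity of $i$ as a part of $\mu$, and the coefficients are as follows. A ribbon is a nonempty edgewise connected skew shape containing no $2\times2$ square; its sign is $(-1)^{h}$ with $h+1$ the number of rows it occupies, and its tail is its southwesternmost cell. * $\chi^{\lambda/\rho}_\nu=\sum_T\mathrm{sign}(T)$ over the standard ribbon tableaux $T$ of shape $\lambda/\rho$ and type $\nu$, that is, chains of partitions $\rho=\lambda^{(0)}\subset\lambda^{(1)}\subset\cdots\subset\lambda^{(r)}=\lambda$ such that $\lambda^{(i)}/\lambda^{(i-1)}$ is a ribbon of size $\nu_i$ and $r=\ell(\nu)$, where $\mathrm{sign}(T)$ is the product of the signs of the ribbons ($\chi^{\lambda/\rho}_\nu=0$ if $\rho\not\subseteq\lambda$). * $\vec\chi^{\,\rho}_{\,\mu}=\sum_T\mathrm{sign}(T)$ over the monotonic ribbon tilings $T$ of shape $\rho$ whose ribbon sizes are, in some order, the parts of $\mu$. A monotonic ribbon tiling of $\rho$ is a decomposition $\rho=\xi^{(1)}\sqcup\cdots\sqcup\xi^{(r)}$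 of its Young diagram into ribbons whose tails occupy columns $c_1<\cdots<c_r$ and such that each initial union $\xi^{(1)}\sqcup\cdots\sqcup\xi^{(i)}$ is the Young diagram of a partition; $\mathrm{sign}(T)$ is the product of the signs of the ribbons. -/

import Mathlib

/-! Symmetric functions are formal power series over `ℂ` in the variables `x₀, x₁, x₂, …`
(usually numbered from `1`); rows and columns of Young diagrams are numbered from `0`. -/

namespace AtomicSymm

open Equiv

noncomputable section

/-! ### Power sums and Schur functions -/

/-- The power sum `p_d = ∑ᵢ xᵢ ^ d` (used for `d > 0` only): the monomials that occur in it are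
the `xᵢ ^ d`, each with coefficient `1`. -/
def powerSum (d : ℕ) : MvPowerSeries ℕ ℂ :=
  open Classical in fun m => if ∃ i : ℕ, m = Finsupp.single i d then 1 else 0

/-- The power sum `p_ν = p_{ν₁} p_{ν₂} ⋯` of a multiset `ν` of parts. -/
def powerSumProd (ν : Multiset ℕ) : MvPowerSeries ℕ ℂ := (ν.map powerSum).prod

/-- The parts of a partition in weakly decreasing order. -/
def partList {n : ℕ} (lam : n.Partition) : List ℕ := lam.parts.sort (· ≥ ·)

/-- The part `lam_i` for `i = 0, 1, 2, …`, with trailing zeros. -/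
def part {n : ℕ} (lam : n.Partition) (i : ℕ) : ℕ := (partList lam).getD i 0

/-- The alternant `ε · x^{β + δ}` in the first `N` variables, where
`ε = ∑_{w ∈ S_N} sign(w) w` permutes the variables and `δ = (N - 1, …, 1, 0)`. -/
def alternant (N : ℕ) (β : ℕ → ℕ) : MvPolynomial ℕ ℂ :=
  ∑ w : Perm (Fin N), (Perm.sign w : ℤ) •
    ∏ i : Fin N, MvPolynomial.X (w i : ℕ) ^ (β i + (N - 1 - (i : ℕ)))

theorem alternant_eq_det (N : ℕ) (β : ℕ → ℕ) :
    alternant N β = Matrix.det (Matrix.of fun i j : Fin N =>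
      (MvPolynomial.X (i : ℕ) : MvPolynomial ℕ ℂ) ^ (β j + (N - 1 - (j : ℕ)))) := by
  rw [Matrix.det_apply]
  rfl

theorem X_sub_X_dvd_alternant (N : ℕ) (β : ℕ → ℕ) {i j : Fin N} (hij : i ≠ j) :
    (MvPolynomial.X (j : ℕ) - MvPolynomial.X (i : ℕ) : MvPolynomial ℕ ℂ) ∣ alternant N β := by
  rw [← Ideal.mem_span_singleton, ← Ideal.Quotient.eq_zero_iff_mem, alternant_eq_det,
    RingHom.map_det]
  refine Matrix.det_zero_of_row_eq hij ?_
  have h : Ideal.Quotient.mk (Ideal.span {(MvPolynomial.X (j : ℕ) - MvPolynomial.X (i : ℕ) :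
      MvPolynomial ℕ ℂ)}) (MvPolynomial.X (i : ℕ)) = Ideal.Quotient.mk _
      (MvPolynomial.X (j : ℕ)) := by
    rw [eq_comm, Ideal.Quotient.eq]
    exact Ideal.mem_span_singleton_self _
  funext l
  simp [h]

theorem isRelPrime_X_sub_X {i j k l : ℕ} (hij : i < j) (hkl : k < l) (hne : (i, j) ≠ (k, l)) :
    IsRelPrime (MvPolynomial.X j - MvPolynomial.X i : MvPolynomial ℕ ℂ)
      (MvPolynomial.X l - MvPolynomial.X k) := by
  have hirr : Irreducible (MvPolynomial.X j - MvPolynomial.X i : MvPolynomial ℕ ℂ) := by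
    have h := MvPolynomial.irreducible_mul_X_add (1 : MvPolynomial ℕ ℂ) (-MvPolynomial.X i) j
      one_ne_zero (by simp) (by simp [MvPolynomial.vars_neg, MvPolynomial.vars_X, hij.ne'])
      isRelPrime_one_left
    simpa [sub_eq_add_neg] using h
  rw [hirr.isRelPrime_iff_not_dvd]
  rintro ⟨q, hq⟩
  have h := congrArg (MvPolynomial.eval fun m : ℕ => if m = i ∨ m = j then (0 : ℂ) else m + 1) hq
  simp only [map_sub, map_mul, MvPolynomial.eval_X, true_or, or_true, if_true, sub_zero,
    zero_mul] at h
  rw [sub_eq_zero] at h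
  have hne' : ¬ (i = k ∧ j = l) := fun h' => hne (by rw [h'.1, h'.2])
  split_ifs at h with h1 h2 h2
  · omega
  · exact absurd h.symm (by exact_mod_cast Nat.succ_ne_zero k)
  · exact absurd h (by exact_mod_cast Nat.succ_ne_zero l)
  · have : l = k := by exact_mod_cast add_right_cancel h
    omega

/-- The denominator of the bialternant formula divides its numerator. -/
theorem alternant_dvd (N : ℕ) (β : ℕ → ℕ) : alternant N 0 ∣ alternant N β := by
  have h0 : alternant N 0 = (Perm.sign (Fin.revPerm : Perm (Fin N)) : MvPolynomial ℕ ℂ) *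
      ∏ i : Fin N, ∏ j ∈ Finset.Ioi i, (MvPolynomial.X (j : ℕ) - MvPolynomial.X (i : ℕ)) := by
    rw [← Matrix.det_vandermonde (fun i : Fin N => (MvPolynomial.X (i : ℕ) : MvPolynomial ℕ ℂ)),
      ← Matrix.det_permute', alternant_eq_det]
    congr 1
    ext1 i j
    simp [Matrix.vandermonde, Fin.val_rev, Nat.sub_sub, Nat.add_comm]
  have hu : IsUnit (Perm.sign (Fin.revPerm : Perm (Fin N)) : MvPolynomial ℕ ℂ) := by
    rcases Int.units_eq_one_or (Perm.sign (Fin.revPerm : Perm (Fin N))) with h | h <;> simp [h]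
  rw [h0, hu.mul_left_dvd, Finset.prod_sigma']
  refine Finset.prod_dvd_of_isRelPrime ?_ ?_
  · rintro ⟨i, j⟩ hij ⟨k, l⟩ hkl hne
    simp only [Finset.coe_sigma, Set.mem_sigma_iff, Finset.mem_coe, Finset.mem_univ,
      Finset.mem_Ioi, true_and] at hij hkl
    refine isRelPrime_X_sub_X hij hkl fun h => hne ?_
    rw [Prod.mk.injEq, Fin.val_inj, Fin.val_inj] at h
    exact Sigma.ext h.1 (heq_of_eq h.2)
  · rintro ⟨i, j⟩ hij
    simp only [Finset.mem_sigma, Finset.mem_univ, Finset.mem_Ioi, true_and] at hij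
    exact X_sub_X_dvd_alternant N β hij.ne

/-- The Schur polynomial `s_lam(x₀, …, x_{N-1}) = (ε · x^{lam + δ}) / (ε · x^δ)`
(for `N ≥ ℓ(lam)`). -/
def schurPoly {n : ℕ} (N : ℕ) (lam : n.Partition) : MvPolynomial ℕ ℂ :=
  (alternant_dvd N (part lam)).choose

/-- The Schur function `s_lam = lim_{N → ∞} s_lam(x₀, …, x_{N-1})`. The limit is taken
coefficientwise: the coefficient of a monomial `m` in `s_lam(x₀, …, x_{N-1})` is the same for all
`N ≥ ℓ(lam)` such that `m` involves the first `N` variables only, and the value of `N` below is such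
(note that `ℓ(lam) ≤ n`). -/
def schur {n : ℕ} (lam : n.Partition) : MvPowerSeries ℕ ℂ :=
  fun m => MvPolynomial.coeff m (schurPoly (max n (m.support.sup id + 1)) lam)

/-! ### Partial permutations and atomic symmetric functions -/

section PartialPermutation

variable {n k : ℕ} (I J : Fin k ↪ Fin n)

/-- The directed edges `i₁ → j₁, …, i_k → j_k` of the graph `G(I, J)` on the vertex set `[n]`. -/
def Edge (u v : Fin n) : Prop := ∃ p : Fin k, I p = u ∧ J p = v

/-- The vertex sets of the connected components of `G(I, J)`, where the direction of the edges is
disregarded. -/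
def components : Finset (Finset (Fin n)) :=
  open Classical in
  Finset.univ.image fun v => Finset.univ.filter fun u => Relation.EqvGen (Edge I J) v u

/-- The subgraph of `G(I, J)` on the vertex set `C` is a directed path `v₀ → v₁ → ⋯ → v_{s-1}`. -/
def IsDirectedPath (C : Finset (Fin n)) : Prop :=
  ∃ v : Fin C.card ≃ C, ∀ x y : Fin C.card,
    Edge I J (v x) (v y) ↔ (y : ℕ) = (x : ℕ) + 1

/-- The subgraph of `G(I, J)` on the vertex set `C` is a directed cycle
`v₀ → v₁ → ⋯ → v_{s-1} → v₀` (a loop if `s = 1`). -/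
def IsDirectedCycle (C : Finset (Fin n)) : Prop :=
  ∃ v : Fin C.card ≃ C, ∀ x y : Fin C.card,
    Edge I J (v x) (v y) ↔ (y : ℕ) = ((x : ℕ) + 1) % C.card

/-- The path type of `(I, J)`: the sizes (numbers of vertices) of the components of `G(I, J)` that
are paths. -/
def pathType : Multiset ℕ :=
  open Classical in ((components I J).filter (IsDirectedPath I J)).val.map Finset.card

/-- The cycle type of `(I, J)`: the sizes (numbers of vertices) of the components of `G(I, J)` that
are cycles. -/
def cycleType : Multiset ℕ :=
  open Classical in ((components I J).filter (IsDirectedCycle I J)).val.map Finset.card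

/-- The indicator function of the permutations `w` with `w(I) = J`. -/
def indicator (w : Perm (Fin n)) : ℂ :=
  open Classical in if ∀ p : Fin k, w (I p) = J p then 1 else 0

/-- The Reynolds operator, which averages a function on `S_n` over conjugation. -/
def reynolds (f : Perm (Fin n) → ℂ) (w : Perm (Fin n)) : ℂ :=
  (n.factorial : ℂ)⁻¹ * ∑ v : Perm (Fin n), f (v⁻¹ * w * v)

/-- The Frobenius characteristic `ch_n f = (1 / n!) ∑_w f(w) p_{cyc(w)}` (of a class function `f`);
`w.partition` is the partition of `n` into the cycle lengths of `w`, fixed points included. -/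
def frobenius (f : Perm (Fin n) → ℂ) : MvPowerSeries ℕ ℂ :=
  (n.factorial : ℂ)⁻¹ • ∑ w : Perm (Fin n), f w • powerSumProd w.partition.parts

/-- The atomic symmetric function `A_{n,I,J} = n! · ch_n (R 1_{I,J})`. -/
def atomic : MvPowerSeries ℕ ℂ :=
  (n.factorial : ℂ) • frobenius (reynolds (indicator I J))

end PartialPermutation

/-! ### Ribbon tableaux and monotonic ribbon tilings -/

/-- The Young diagram of a partition. -/
def diagram {n : ℕ} (lam : n.Partition) : YoungDiagram :=
  YoungDiagram.ofRowLens (partList lam) (lam.parts.pairwise_sort (· ≥ ·)).sortedGE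

/-- `m(μ)! = ∏_{i ≥ 1} m_i(μ)!`, where `m_i(μ)` is the multiplicity of the part `i`. -/
def multFactorial {n : ℕ} (μ : n.Partition) : ℕ :=
  ∏ i ∈ μ.parts.toFinset, (μ.parts.count i).factorial

/-- Two cells share an edge. -/
def Adjacent (c d : ℕ × ℕ) : Prop :=
  (c.1 = d.1 ∧ (c.2 + 1 = d.2 ∨ d.2 + 1 = c.2)) ∨
    (c.2 = d.2 ∧ (c.1 + 1 = d.1 ∨ d.1 + 1 = c.1))

/-- A ribbon: a nonempty skew shape that is edgewise connected and contains no `2 × 2` square.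
A cell is a pair (row, column). -/
structure IsRibbon (S : Finset (ℕ × ℕ)) : Prop where
  skew : ∃ α β : YoungDiagram, α ≤ β ∧ S = β.cells \ α.cells
  nonempty : S.Nonempty
  connected : ∀ c ∈ S, ∀ d ∈ S,
    Relation.ReflTransGen (fun x y => x ∈ S ∧ y ∈ S ∧ Adjacent x y) c d
  no_square : ¬ ∃ i j : ℕ, (i, j) ∈ S ∧ (i + 1, j) ∈ S ∧ (i, j + 1) ∈ S ∧ (i + 1, j + 1) ∈ S

/-- The height of a ribbon: the number of rows that it occupies, less one. -/
def height (S : Finset (ℕ × ℕ)) : ℕ := (S.image Prod.fst).card - 1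

/-- The sign of a ribbon. -/
def ribbonSign (S : Finset (ℕ × ℕ)) : ℤ := (-1) ^ height S

/-- `c` is the tail of the ribbon `S`, its southwesternmost cell. -/
def IsTail (S : Finset (ℕ × ℕ)) (c : ℕ × ℕ) : Prop :=
  c ∈ S ∧ ∀ d ∈ S, d.1 ≤ c.1 ∧ c.2 ≤ d.2

/-- A standard ribbon tableau of shape `lam / ρ` with `r` ribbons: a chain
`ρ = lam⁽⁰⁾ ⊂ lam⁽¹⁾ ⊂ ⋯ ⊂ lam⁽ʳ⁾ = lam` whose successive differences are ribbons. -/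
@[ext]
structure RibbonTableau (ρ lam : YoungDiagram) (r : ℕ) where
  chain : Fin (r + 1) → YoungDiagram
  chain_zero : chain 0 = ρ
  chain_last : chain (Fin.last r) = lam
  chain_le : ∀ i : Fin r, chain i.castSucc ≤ chain i.succ
  isRibbon : ∀ i : Fin r, IsRibbon ((chain i.succ).cells \ (chain i.castSucc).cells)

namespace RibbonTableau

variable {ρ lam : YoungDiagram} {r : ℕ}

/-- The `i`-th ribbon `ξ⁽ⁱ⁾`, for `i = 0, …, r - 1`. -/
def ribbon (T : RibbonTableau ρ lam r) (i : Fin r) : Finset (ℕ × ℕ) :=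
  (T.chain i.succ).cells \ (T.chain i.castSucc).cells

/-- The type of `T`: the sequence of the sizes of its ribbons. -/
def type (T : RibbonTableau ρ lam r) : List ℕ := List.ofFn fun i => (T.ribbon i).card

/-- The sign of `T`: the product of the signs of its ribbons. -/
def sign (T : RibbonTableau ρ lam r) : ℤ := ∏ i, ribbonSign (T.ribbon i)

/-- The tails of the ribbons occupy columns `c₁ < ⋯ < c_r`. -/
def IsMonotonic (T : RibbonTableau ρ lam r) : Prop :=
  ∃ t : Fin r → ℕ × ℕ, (∀ i, IsTail (T.ribbon i) (t i)) ∧ StrictMono fun i => (t i).2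

theorem chain_le_shape (T : RibbonTableau ρ lam r) (i : Fin (r + 1)) : T.chain i ≤ lam := by
  have h : Monotone T.chain := Fin.monotone_iff_le_succ.2 T.chain_le
  simpa [T.chain_last] using h (Fin.le_last i)

instance : Finite (RibbonTableau ρ lam r) := by
  refine Finite.of_injective (β := Fin (r + 1) → lam.cells.powerset)
    (fun T i => ⟨(T.chain i).cells, Finset.mem_powerset.2
      (YoungDiagram.cells_subset_iff.2 (T.chain_le_shape i))⟩) fun T U h => ?_
  ext1
  funext i
  have := congrArg Subtype.val (congrFun h i)
  exact YoungDiagram.ext this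

instance : Fintype (RibbonTableau ρ lam r) := Fintype.ofFinite _

end RibbonTableau

/-- The skew character value `χ^{lam/ρ}_ν = ∑_T sign(T)`, summed over the standard ribbon tableaux
`T` of shape `lam / ρ` and type `(ν₁ ≥ ν₂ ≥ ⋯)`. It is `0` if `ρ` is not contained in `lam`. -/
def skewChar {n a b : ℕ} (lam : n.Partition) (ρ : a.Partition) (ν : b.Partition) : ℤ :=
  open Classical in
  ∑ T : RibbonTableau (diagram ρ) (diagram lam) (partList ν).length,
    if T.type = partList ν then T.sign else 0

/-- The monotonic tiling enumerator `∑_T sign(T)`, summed over the monotonic ribbon tilings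
`ρ = ξ⁽¹⁾ ⊔ ⋯ ⊔ ξ⁽ʳ⁾` whose ribbon sizes are, in some order, the parts of `μ`. Since the initial
unions of such a tiling are Young diagrams, it is the same as a monotonic standard ribbon tableau
of the straight shape `ρ / ∅`. -/
def pathChar {a : ℕ} (ρ μ : a.Partition) : ℤ :=
  open Classical in
  ∑ T : RibbonTableau ⊥ (diagram ρ) μ.parts.card,
    if T.IsMonotonic ∧ (T.type : Multiset ℕ) = μ.parts then T.sign else 0

end

end AtomicSymm

/-! Conjugation preserves cycle type, so the average disappears and the atomic function is the sum
of `p_{cyc(w)}` over the permutations `w` extending `(I, J)` (`atomic_eq`). In `N` variables,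
`p_{cyc(w)}` enumerates the `w`-invariant colorings of `[n]` (`prod_psum_partition`). Interchanging
the sums leaves the colorings constant on the components of the graph, each counted once for every
extension `w` that preserves it. That number is `∏_v c_v!`, where `c_v` is the number of path
components of color `v` (`card_perm_extending`, `card_ends`). The sum thus factors into power sums
of the cycle sizes and a factorial-weighted sum `colorSum` over the colorings of the paths
(`sum_extensions`).

By the bialternant formula it remains to expand the antisymmetrization of `x^δ` times this product.
Both factors use one principle (`sum_lengthen_row`): lengthening row `i` of a diagram by `d` in
`x^{λ+δ}` either creates two equal exponents, and then the antisymmetrization vanishes, or after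
sorting adds a ribbon of size `d` with its tail in row `i`, the sign of the ribbon being that of the
sorting cycle. For a power sum every row is allowed; this is the usual Murnaghan–Nakayama rule
(`antisymm_mul_psum_prod`).

For the paths, single out an element `s` of the largest color `i` in use; the factorial weights make
this an exact recursion (`colorSum_firstVars`). The remaining factor is symmetric in the variables
`0, …, i` only, but the swap and the sorting cycle move nothing beyond `i`, so the principle still
applies. Later tails then lie in rows at most `i`, and weakly rising tails are the same as tails
moving strictly right (`tail_column_lt_iff`): the tilings are monotonic. Paths of equal size are
distinguishable as elements but not as ribbons, whence `m(μ)!` (`antisymm_mul_colorSum`). -/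

namespace AtomicSymm

open Equiv

/-! ### Ribbons and row lengths -/

/-- The skew shape `Z / Y` is a ribbon that occupies the rows `i₀, …, i₁`, described by the row
lengths. -/
structure RibbonRows (Y Z : YoungDiagram) (i₀ i₁ : ℕ) : Prop where
  le : i₀ ≤ i₁
  outside : ∀ i, i < i₀ ∨ i₁ < i → Z.rowLen i = Y.rowLen i
  inside : ∀ i, i₀ ≤ i → i < i₁ → Z.rowLen (i + 1) = Y.rowLen i + 1
  top : Y.rowLen i₀ < Z.rowLen i₀

theorem le_iff_rowLen_le {Y Z : YoungDiagram} : Y ≤ Z ↔ ∀ i, Y.rowLen i ≤ Z.rowLen i := by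
  constructor
  · intro h i
    by_contra! hlt
    have := h (YoungDiagram.mem_iff_lt_rowLen.2 hlt)
    exact lt_irrefl _ (YoungDiagram.mem_iff_lt_rowLen.1 this)
  · rintro h ⟨i, j⟩ hc
    exact YoungDiagram.mem_iff_lt_rowLen.2 ((YoungDiagram.mem_iff_lt_rowLen.1 hc).trans_le (h i))

theorem rowLen_injective : Function.Injective YoungDiagram.rowLen := fun _ _ h =>
  le_antisymm (le_iff_rowLen_le.2 fun i => (congrFun h i).le)
    (le_iff_rowLen_le.2 fun i => (congrFun h i).ge)

theorem mem_skew_iff {Y Z : YoungDiagram} {i j : ℕ} :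
    (i, j) ∈ Z.cells \ Y.cells ↔ Y.rowLen i ≤ j ∧ j < Z.rowLen i := by
  simp [YoungDiagram.mem_iff_lt_rowLen, and_comm]

namespace RibbonRows

variable {Y Z : YoungDiagram} {i₀ i₁ : ℕ} (h : RibbonRows Y Z i₀ i₁)
include h

theorem lt_rowLen {i : ℕ} (h₀ : i₀ ≤ i) (h₁ : i ≤ i₁) : Y.rowLen i < Z.rowLen i := by
  rcases h₀.eq_or_lt with rfl | h₀
  · exact h.top
  · obtain ⟨k, rfl⟩ : ∃ k, i = k + 1 := ⟨i - 1, by omega⟩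
    rw [h.inside k (by omega) (by omega)]
    exact Nat.lt_succ_of_le (Y.rowLen_anti _ _ (by omega))

theorem diagram_le : Y ≤ Z := le_iff_rowLen_le.2 fun i => by
  by_cases hi : i < i₀ ∨ i₁ < i
  · exact (h.outside i hi).ge
  · push Not at hi
    exact (h.lt_rowLen hi.1 hi.2).le

theorem mem_rows_iff {i j : ℕ} : (i, j) ∈ Z.cells \ Y.cells ↔
    (i₀ ≤ i ∧ i ≤ i₁) ∧ Y.rowLen i ≤ j ∧ j < Z.rowLen i := by
  rw [mem_skew_iff]
  refine ⟨fun hj => ⟨?_, hj⟩, fun hj => hj.2⟩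
  by_contra hi
  have := h.outside i (by omega)
  omega

theorem image_fst : (Z.cells \ Y.cells).image Prod.fst = Finset.Icc i₀ i₁ := by
  ext i
  simp only [Finset.mem_image, Finset.mem_Icc, Prod.exists, exists_and_right, exists_eq_right]
  constructor
  · rintro ⟨j, hj⟩
    exact (h.mem_rows_iff.1 hj).1
  · intro hi
    exact ⟨Y.rowLen i, h.mem_rows_iff.2 ⟨hi, le_rfl, h.lt_rowLen hi.1 hi.2⟩⟩

theorem height_eq : height (Z.cells \ Y.cells) = i₁ - i₀ := by
  rw [height, h.image_fst, Nat.card_Icc]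
  have := h.le
  omega

theorem isTail_iff {c : ℕ × ℕ} : IsTail (Z.cells \ Y.cells) c ↔ c = (i₁, Y.rowLen i₁) := by
  have hm : (i₁, Y.rowLen i₁) ∈ Z.cells \ Y.cells :=
    h.mem_rows_iff.2 ⟨⟨h.le, le_rfl⟩, le_rfl, h.lt_rowLen h.le le_rfl⟩
  constructor
  · rintro ⟨hc, hd⟩
    obtain ⟨i, j⟩ := c
    have h1 := hd _ hm
    have h2 := h.mem_rows_iff.1 hc
    simp only at h1
    obtain rfl : i = i₁ := by omega
    exact Prod.ext rfl (by simp only; omega)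
  · rintro rfl
    refine ⟨hm, ?_⟩
    rintro ⟨i, j⟩ hd
    have h2 := h.mem_rows_iff.1 hd
    have := Y.rowLen_anti i i₁ h2.1.2
    exact ⟨h2.1.2, by simp only; omega⟩

/-- From any cell, walk left to the first cell of its row. The cell below that one is the last cell
of the next row, by `inside`, so the walk can go on down to the tail. -/
theorem reaches_tail : ∀ c ∈ Z.cells \ Y.cells, Relation.ReflTransGen
    (fun x y => x ∈ Z.cells \ Y.cells ∧ y ∈ Z.cells \ Y.cells ∧ Adjacent x y)
    c (i₁, Y.rowLen i₁) := by
  have row : ∀ i j, (i, j) ∈ Z.cells \ Y.cells → Relation.ReflTransGen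
      (fun x y => x ∈ Z.cells \ Y.cells ∧ y ∈ Z.cells \ Y.cells ∧ Adjacent x y)
      (i, j) (i, Y.rowLen i) := by
    intro i j hj
    induction j with
    | zero =>
      have := (h.mem_rows_iff.1 hj).2
      rw [show Y.rowLen i = 0 by omega]
    | succ j ih =>
      by_cases hji : Y.rowLen i = j + 1
      · rw [hji]
      · have := h.mem_rows_iff.1 hj
        have hj' : (i, j) ∈ Z.cells \ Y.cells := h.mem_rows_iff.2 ⟨this.1, by omega, by omega⟩
        exact .head ⟨hj, hj', .inl ⟨rfl, .inr rfl⟩⟩ (ih hj')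
  have col : ∀ k i, i + k = i₁ → i₀ ≤ i → Relation.ReflTransGen
      (fun x y => x ∈ Z.cells \ Y.cells ∧ y ∈ Z.cells \ Y.cells ∧ Adjacent x y)
      (i, Y.rowLen i) (i₁, Y.rowLen i₁) := by
    intro k
    induction k with
    | zero =>
      rintro i rfl -
      exact .refl
    | succ k ih =>
      intro i hi h₀
      have h1 : (i, Y.rowLen i) ∈ Z.cells \ Y.cells :=
        h.mem_rows_iff.2 ⟨⟨h₀, by omega⟩, le_rfl, h.lt_rowLen h₀ (by omega)⟩
      have h2 : (i + 1, Y.rowLen i) ∈ Z.cells \ Y.cells :=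
        h.mem_rows_iff.2 ⟨⟨by omega, by omega⟩, Y.rowLen_anti _ _ (by omega),
          by rw [h.inside i h₀ (by omega)]; omega⟩
      exact .head ⟨h1, h2, .inr ⟨rfl, .inl rfl⟩⟩ ((row _ _ h2).trans (ih _ (by omega) (by omega)))
  rintro ⟨i, j⟩ hc
  have := (h.mem_rows_iff.1 hc).1
  exact (row i j hc).trans (col (i₁ - i) i (by omega) this.1)

theorem isRibbon : IsRibbon (Z.cells \ Y.cells) where
  skew := ⟨Y, Z, h.diagram_le, rfl⟩
  nonempty := ⟨(i₀, Y.rowLen i₀), h.mem_rows_iff.2 ⟨⟨le_rfl, h.le⟩, le_rfl, h.top⟩⟩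
  connected c hc d hd := by
    refine (h.reaches_tail c hc).trans ?_
    have := Relation.reflTransGen_swap.2 (h.reaches_tail d hd)
    refine Relation.ReflTransGen.mono (fun x y hxy => ⟨hxy.2.1, hxy.1, ?_⟩) _ _ this
    have := hxy.2.2
    unfold Adjacent at this ⊢
    omega
  no_square := by
    rintro ⟨i, j, h1, h2, h3, h4⟩
    have h1 := h.mem_rows_iff.1 h1
    have h4 := h.mem_rows_iff.1 h4
    have := h.inside i h1.1.1 (by omega)
    omega

end RibbonRows

/-- Connectedness gives `Y.rowLen i + 1 ≤ Z.rowLen (i + 1)` between the extreme rows; the absence of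
a `2 × 2` square gives the reverse inequality. -/
theorem IsRibbon.exists_rows {Y Z : YoungDiagram} (hYZ : Y ≤ Z)
    (h : IsRibbon (Z.cells \ Y.cells)) : ∃ i₀ i₁, RibbonRows Y Z i₀ i₁ := by
  classical
  have hle := le_iff_rowLen_le.1 hYZ
  set R := (Z.cells \ Y.cells).image Prod.fst with hR
  have memR : ∀ i, i ∈ R ↔ Y.rowLen i < Z.rowLen i := by
    intro i
    simp only [hR, Finset.mem_image, Prod.exists, exists_and_right, exists_eq_right, mem_skew_iff]
    exact ⟨fun ⟨j, h1, h2⟩ => by omega, fun h => ⟨Y.rowLen i, le_rfl, h⟩⟩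
  have hne : R.Nonempty := h.nonempty.image _
  set i₀ := R.min' hne
  set i₁ := R.max' hne
  have h₀ : i₀ ∈ R := R.min'_mem hne
  have h₁ : i₁ ∈ R := R.max'_mem hne
  -- an edge crosses every horizontal line between the first and the last row
  have cross : ∀ i, i₀ ≤ i → i < i₁ → Y.rowLen i < Z.rowLen (i + 1) := by
    intro i hi hi'
    by_contra! hlt
    obtain ⟨c, hc, hc'⟩ := Finset.mem_image.1 h₀
    obtain ⟨d, hd, hd'⟩ := Finset.mem_image.1 h₁
    have key : ∀ e, Relation.ReflTransGen
        (fun x y => x ∈ Z.cells \ Y.cells ∧ y ∈ Z.cells \ Y.cells ∧ Adjacent x y) c e →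
        e.1 ≤ i := by
      intro e he
      induction he with
      | refl => omega
      | @tail x y _ hxy ih =>
        obtain ⟨x1, x2⟩ := x
        obtain ⟨y1, y2⟩ := y
        obtain ⟨hx, hy, hadj⟩ := hxy
        rw [mem_skew_iff] at hx hy
        unfold Adjacent at hadj
        simp only at hadj ih ⊢
        by_contra! hy1
        obtain rfl : x1 = i := by omega
        obtain rfl : y1 = x1 + 1 := by omega
        omega
    have := key d (h.connected c hc d hd)
    omega
  refine ⟨i₀, i₁, R.min'_le _ h₁, ?_, ?_, (memR _).1 h₀⟩
  · intro i hi
    by_contra hne'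
    have hiR : i ∈ R := (memR i).2 (lt_of_le_of_ne (hle i) (Ne.symm hne'))
    have := R.min'_le _ hiR
    have := R.le_max' _ hiR
    omega
  · intro i hi hi'
    have hc := cross i hi hi'
    by_contra hne'
    -- If row `i + 1` were longer, a square would start at the first skew cell of row `i`.
    refine h.no_square ⟨i, Y.rowLen i, ?_, ?_, ?_, ?_⟩ <;> rw [mem_skew_iff]
    all_goals
      have := Y.rowLen_anti i (i + 1) (by omega)
      have := Z.rowLen_anti i (i + 1) (by omega)
      omega

/-- The last row that a set of cells occupies. -/
def tailRow (S : Finset (ℕ × ℕ)) : ℕ := S.sup Prod.fst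

theorem RibbonRows.tailRow_eq {Y Z : YoungDiagram} {i₀ i₁ : ℕ} (h : RibbonRows Y Z i₀ i₁) :
    tailRow (Z.cells \ Y.cells) = i₁ := by
  refine le_antisymm (Finset.sup_le ?_) ?_
  · rintro ⟨i, j⟩ hc
    exact (h.mem_rows_iff.1 hc).1.2
  · exact Finset.le_sup (f := Prod.fst) (b := (i₁, Y.rowLen i₁))
      (h.mem_rows_iff.2 ⟨⟨h.le, le_rfl⟩, le_rfl, h.lt_rowLen h.le le_rfl⟩)

theorem IsRibbon.rows {Y Z : YoungDiagram} (hYZ : Y ≤ Z) (h : IsRibbon (Z.cells \ Y.cells)) :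
    ∃ i₀, RibbonRows Y Z i₀ (tailRow (Z.cells \ Y.cells)) := by
  obtain ⟨i₀, i₁, h⟩ := h.exists_rows hYZ
  exact ⟨i₀, h.tailRow_eq.symm ▸ h⟩

/-- The tail of the second of two successive ribbons lies in a column further to the right if and
only if it does not lie in a lower row. -/
theorem tail_column_lt_iff {X Y Z : YoungDiagram} {i₀ i₁ j₀ j₁ : ℕ} (h : RibbonRows X Y i₀ i₁)
    (_ : RibbonRows Y Z j₀ j₁) : X.rowLen i₁ < Y.rowLen j₁ ↔ j₁ ≤ i₁ := by
  constructor
  · intro hlt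
    by_contra! hij
    rw [h.outside j₁ (.inr hij)] at hlt
    exact hlt.not_ge (X.rowLen_anti _ _ hij.le)
  · intro hij
    exact (h.lt_rowLen h.le le_rfl).trans_le (Y.rowLen_anti _ _ hij)

/-- Tails are unique and both conditions can be tested on consecutive ribbons, where
`tail_column_lt_iff` compares them. The row form is the one that the recursion on variables
produces. -/
theorem RibbonTableau.isMonotonic_iff {Y Z : YoungDiagram} {r : ℕ} (T : RibbonTableau Y Z r) :
    T.IsMonotonic ↔ Antitone fun i => tailRow (T.ribbon i) := by
  choose i₀ hi using fun i => (T.isRibbon i).rows (T.chain_le i)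
  have htail : ∀ i c, IsTail (T.ribbon i) c ↔
      c = (tailRow (T.ribbon i), (T.chain i.castSucc).rowLen (tailRow (T.ribbon i))) :=
    fun i c => (hi i).isTail_iff
  have hmono : T.IsMonotonic ↔
      StrictMono fun i => (T.chain i.castSucc).rowLen (tailRow (T.ribbon i)) := by
    constructor
    · rintro ⟨t, ht, hm⟩
      simpa [fun i => (htail i _).1 (ht i)] using hm
    · intro hm
      exact ⟨_, fun i => (htail i _).2 rfl, hm⟩
  rw [hmono]
  cases r with
  | zero => exact ⟨fun _ i => i.elim0, fun _ i => i.elim0⟩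
  | succ r =>
    rw [Fin.strictMono_iff_lt_succ, Fin.antitone_iff_succ_le]
    refine forall_congr' fun i => ?_
    have h1 := hi i.castSucc
    have h2 := hi i.succ
    rw [Fin.castSucc_succ] at h2
    exact tail_column_lt_iff h1 h2

/-! ### Young diagrams with few cells -/

theorem rowLen_le_card (Y : YoungDiagram) (i : ℕ) : Y.rowLen i ≤ Y.card := by
  rw [Y.rowLen_eq_card]
  exact Finset.card_le_card (Finset.filter_subset _ _)

theorem lt_card_of_rowLen_pos {Y : YoungDiagram} {i : ℕ} (h : 0 < Y.rowLen i) : i < Y.card := by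
  have h1 := YoungDiagram.mem_iff_lt_colLen.1 (YoungDiagram.mem_iff_lt_rowLen.2 h)
  rw [Y.colLen_eq_card] at h1
  exact h1.trans_le (Finset.card_le_card (Finset.filter_subset _ _))

theorem rowLen_eq_zero {Y : YoungDiagram} {i : ℕ} (h : Y.card ≤ i) : Y.rowLen i = 0 := by
  by_contra h0
  exact (lt_card_of_rowLen_pos (Nat.pos_of_ne_zero h0)).not_ge h

theorem finite_card_le (N : ℕ) : {Y : YoungDiagram | Y.card ≤ N}.Finite := by
  refine Set.Finite.of_finite_image (f := YoungDiagram.cells)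
    ((Finset.range N ×ˢ Finset.range N).powerset.finite_toSet.subset ?_)
    fun _ _ _ _ h => YoungDiagram.ext h
  rintro _ ⟨Y, hY, rfl⟩
  simp only [Finset.coe_powerset, Set.mem_preimage, Set.mem_powerset_iff]
  rintro ⟨i, j⟩ hc
  have h := YoungDiagram.mem_iff_lt_rowLen.1 (Finset.mem_coe.1 hc)
  have h1 := lt_card_of_rowLen_pos ((Nat.zero_le _).trans_lt h)
  have h2 := rowLen_le_card Y i
  have : Y.card ≤ N := hY
  simp only [Finset.coe_product, Finset.coe_range, Set.mem_prod, Set.mem_Iio]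
  omega

/-- The Young diagrams with at most `N` cells. -/
noncomputable def diagramsLE (N : ℕ) : Finset YoungDiagram := (finite_card_le N).toFinset

@[simp]
theorem mem_diagramsLE {N : ℕ} {Y : YoungDiagram} : Y ∈ diagramsLE N ↔ Y.card ≤ N := by
  simp [diagramsLE]

theorem card_eq_sum_rowLen {N : ℕ} {Y : YoungDiagram} (h : ∀ i, N ≤ i → Y.rowLen i = 0) :
    Y.card = ∑ i : Fin N, Y.rowLen i := by
  rw [Fin.sum_univ_eq_sum_range, YoungDiagram.card,
    Finset.card_eq_sum_card_fiberwise (f := Prod.fst) (t := Finset.range N)]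
  · exact Finset.sum_congr rfl fun i _ => by rw [Y.rowLen_eq_card]; rfl
  · rintro ⟨i, j⟩ hc
    by_contra hi
    have := YoungDiagram.mem_iff_lt_rowLen.1 (Finset.mem_coe.1 hc)
    rw [h i (by simpa using hi)] at this
    omega

theorem exists_rowLen_eq {f : ℕ → ℕ} (hf : Antitone f) {N : ℕ} (h0 : ∀ i, N ≤ i → f i = 0) :
    ∃ Y : YoungDiagram, Y.rowLen = f := by
  refine ⟨⟨{c ∈ Finset.range N ×ˢ Finset.range (f 0) | c.2 < f c.1}, ?_⟩, ?_⟩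
  · rintro ⟨i, j⟩ ⟨i', j'⟩ hle h
    have hi : i' ≤ i := hle.1
    have hj : j' ≤ j := hle.2
    have := hf hi
    simp only [Finset.coe_filter, Finset.mem_product, Finset.mem_range, Set.mem_ofPred_eq] at h ⊢
    omega
  · funext i
    refine eq_of_forall_lt_iff fun j => ?_
    rw [← YoungDiagram.mem_iff_lt_rowLen, ← YoungDiagram.mem_cells]
    simp only [Finset.mem_filter, Finset.mem_product, Finset.mem_range]
    refine ⟨fun h => h.2, fun h => ⟨⟨?_, h.trans_le (hf (Nat.zero_le i))⟩, h⟩⟩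
    by_contra hi
    rw [h0 i (by omega)] at h
    omega

/-! ### Adding a ribbon -/

/-- The exponents of `x^{λ + δ}` in `N` variables. -/
def expVec (N : ℕ) (Y : YoungDiagram) (j : Fin N) : ℕ := Y.rowLen j + (N - 1 - j)

namespace RibbonRows

variable {Y Z : YoungDiagram} {N i₀ i₁ : ℕ} (h : RibbonRows Y Z i₀ i₁)
include h

theorem lt_of_card_le (hZ : Z.card ≤ N) : i₁ < N :=
  (lt_card_of_rowLen_pos ((Nat.zero_le _).trans_lt (h.lt_rowLen h.le le_rfl))).trans_le hZ

theorem rowLen_tail_lt : Y.rowLen i₁ < Z.rowLen i₀ :=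
  (h.lt_rowLen h.le le_rfl).trans_le (Z.rowLen_anti _ _ h.le)

/-- This is the sorting step: the increased entry `i₁` moves up to place `i₀`, and the entries in
between move down one place. There `δ` drops by one, which the extra cell in `inside` makes up for.
-/
theorem expVec_cycleIcc (h₁ : i₁ < N) (j : Fin N) :
    expVec N Z (Fin.cycleIcc ⟨i₀, h.le.trans_lt h₁⟩ ⟨i₁, h₁⟩ j) =
      expVec N Y j + if (j : ℕ) = i₁ then Z.rowLen i₀ + (i₁ - i₀) - Y.rowLen i₁ else 0 := by
  have : NeZero N := ⟨by omega⟩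
  have hle := h.le
  have hlt := h.rowLen_tail_lt
  rcases lt_or_ge (j : ℕ) i₀ with hj | hj
  · rw [Fin.cycleIcc_of_lt (by exact hj), if_neg (by omega), expVec, expVec,
      h.outside _ (.inl hj), add_zero]
  rcases lt_trichotomy (j : ℕ) i₁ with hj' | hj' | hj'
  · rw [Fin.cycleIcc_of_ge_of_lt (by exact hj) (by exact hj'), if_neg (by omega), expVec, expVec,
      Fin.val_add_one_of_lt' (by omega), h.inside _ hj hj']
    omega
  · obtain rfl : j = ⟨i₁, h₁⟩ := Fin.ext hj'
    rw [Fin.cycleIcc_of_last (by exact h.le), if_pos rfl, expVec, expVec]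
    simp only
    omega
  · rw [Fin.cycleIcc_of_gt (by exact hj'), if_neg (by omega), expVec, expVec,
      h.outside _ (.inr hj'), add_zero]

/-- Sorting does not change the sum of the exponents, so the amount added to the entry `i₁` is the
number of new cells. -/
theorem card_eq (hZ : Z.card ≤ N) :
    (Z.cells \ Y.cells).card = Z.rowLen i₀ + (i₁ - i₀) - Y.rowLen i₁ := by
  have h₁ := h.lt_of_card_le hZ
  have hYZ : Y.cells ⊆ Z.cells := YoungDiagram.cells_subset_iff.2 h.diagram_le
  have hY : Y.card ≤ N := (Finset.card_le_card hYZ).trans hZ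
  have e := Equiv.sum_comp (Fin.cycleIcc ⟨i₀, h.le.trans_lt h₁⟩ ⟨i₁, h₁⟩) (expVec N Z)
  simp only [h.expVec_cycleIcc h₁] at e
  simp only [expVec, Finset.sum_add_distrib] at e
  rw [← card_eq_sum_rowLen fun i hi => rowLen_eq_zero (hY.trans hi),
    ← card_eq_sum_rowLen fun i hi => rowLen_eq_zero (hZ.trans hi),
    Finset.sum_eq_single (⟨i₁, h₁⟩ : Fin N) (fun j _ hj => if_neg fun h' => hj (Fin.ext h'))
      (by simp), if_pos rfl] at e
  rw [Finset.card_sdiff_of_subset hYZ]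
  unfold YoungDiagram.card at e
  omega

/-- A ribbon added to `Y` is determined by its size and tail row. If it started strictly higher, its
top row would also end further right, since `Z'.rowLen i₀' ≤ Y.rowLen (i₀' - 1) ≤ Y.rowLen i₀ <
Z.rowLen i₀`, and it would be larger. -/
theorem eq_of_card_eq {Z' : YoungDiagram} {i₀' : ℕ} (h' : RibbonRows Y Z' i₀' i₁)
    (hle : i₀ ≤ i₀')
    (hc : Z.rowLen i₀ + (i₁ - i₀) - Y.rowLen i₁ = Z'.rowLen i₀' + (i₁ - i₀') - Y.rowLen i₁) :
    Z = Z' := by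
  have := h.rowLen_tail_lt
  have := h'.rowLen_tail_lt
  have := h.le
  have := h'.le
  rcases hle.eq_or_lt with rfl | hlt
  · refine rowLen_injective (funext fun i => ?_)
    by_cases hi : i < i₀ ∨ i₁ < i
    · rw [h.outside i hi, h'.outside i hi]
    rcases eq_or_ne i i₀ with rfl | hi'
    · omega
    · obtain ⟨k, rfl⟩ : ∃ k, i = k + 1 := ⟨i - 1, by omega⟩
      rw [h.inside k (by omega) (by omega), h'.inside k (by omega) (by omega)]
  · exfalso
    have h1 := Z'.rowLen_anti (i₀' - 1) i₀' (by omega)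
    rw [h'.outside (i₀' - 1) (.inl (by omega))] at h1
    have h2 := Y.rowLen_anti i₀ (i₀' - 1) (by omega)
    have h3 := h.top
    omega

theorem sign_cycleIcc (h₁ : i₁ < N) :
    Perm.sign (Fin.cycleIcc (⟨i₀, h.le.trans_lt h₁⟩ : Fin N) ⟨i₁, h₁⟩) =
      (-1) ^ height (Z.cells \ Y.cells) := by
  rw [Fin.sign_cycleIcc_of_le (by exact h.le), h.height_eq]

end RibbonRows

/-- Lengthening the row `i` by `d` either produces two equal entries of the vector of exponents, or
amounts to adding a ribbon. -/
theorem exists_ribbonRows {N d i : ℕ} {Y : YoungDiagram} (hY : Y.card + d ≤ N) (hd : 0 < d)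
    (hi : i < N) :
    (∃ j : Fin N, (j : ℕ) < i ∧ expVec N Y j = expVec N Y ⟨i, hi⟩ + d) ∨
      ∃ Z i₀, RibbonRows Y Z i₀ i ∧ Z.card ≤ N ∧ (Z.cells \ Y.cells).card = d := by
  classical
  -- The first such `j` is the place to which the increased entry gets sorted, hence the top row of
  -- the ribbon.
  have hex : ∃ j, j ≤ i ∧ Y.rowLen j + (N - 1 - j) < Y.rowLen i + (N - 1 - i) + d :=
    ⟨i, le_rfl, by omega⟩
  set i₀ := Nat.find hex with hi₀
  obtain ⟨hle, hlt⟩ := Nat.find_spec hex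
  rw [← hi₀] at hle hlt
  by_cases hrep : ∃ j : Fin N, (j : ℕ) < i ∧ expVec N Y j = expVec N Y ⟨i, hi⟩ + d
  · exact .inl hrep
  right
  have hprev : ∀ j, j < i₀ → Y.rowLen i + (N - 1 - i) + d < Y.rowLen j + (N - 1 - j) := by
    intro j hj
    have h1 := Nat.find_min hex hj
    by_contra h2
    exact hrep ⟨⟨j, by omega⟩, by simp only; omega, by simp only [expVec]; omega⟩
  -- The row lengths read off from the sorted exponents: rows `i₀, …, i - 1` move down and gain a
  -- cell each, and the lengthened row arrives at `i₀` with `i - i₀` cells fewer.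
  set f : ℕ → ℕ := fun j => if j < i₀ ∨ i < j then Y.rowLen j else
    if j = i₀ then Y.rowLen i + d - (i - i₀) else Y.rowLen (j - 1) + 1 with hf
  have hanti : Antitone f := by
    refine antitone_nat_of_succ_le fun j => ?_
    have h1 := Y.rowLen_anti j (j + 1) (by omega)
    have h2 := Y.rowLen_anti (j - 1) j (by omega)
    have h3 := hprev j
    simp only [hf, Nat.add_sub_cancel]
    by_cases h4 : j + 1 = i₀
    · split_ifs <;> omega
    by_cases h5 : j = i₀
    · subst h5
      split_ifs <;> omega
    split_ifs <;> omega
  obtain ⟨Z, hZ⟩ := exists_rowLen_eq hanti (N := N) fun j hj => by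
    simp only [hf, if_pos (Or.inr (hi.trans_le hj))]
    exact rowLen_eq_zero (by omega)
  have hR : RibbonRows Y Z i₀ i := by
    refine ⟨hle, fun j hj => ?_, fun j hj hj' => ?_, ?_⟩
    · simp only [hZ, hf, if_pos hj]
    · rw [hZ, hf]
      simp only
      rw [if_neg (by omega), if_neg (by omega), Nat.add_sub_cancel]
    · rw [hZ, hf]
      simp only
      rw [if_neg (by omega), if_pos trivial]
      omega
  have hcard := hR.card_eq le_rfl
  have hZ0 : Z.rowLen i₀ = Y.rowLen i + d - (i - i₀) := by
    rw [hZ, hf]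
    simp only
    rw [if_neg (by omega), if_pos trivial]
  rw [hZ0] at hcard
  have hYZ := Finset.card_sdiff_add_card_eq_card
    (YoungDiagram.cells_subset_iff.2 hR.diagram_le)
  refine ⟨Z, i₀, hR, ?_, ?_⟩
  · unfold YoungDiagram.card at *
    omega
  · omega

open Classical in
/-- The relation between lengthening a row and adding a ribbon, for functions of the exponents that
are alternating. -/
theorem sum_lengthen_row {R : Type*} [AddCommGroup R] [IsAddTorsionFree R] {N d q : ℕ}
    {Y : YoungDiagram} (hY : Y.card + d ≤ N) (hd : 0 < d) (hq : q ≤ N)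
    (Φ : ℕ → (Fin N → ℕ) → R)
    (hΦ : ∀ (i : ℕ) (σ : Perm (Fin N)), (∀ j : Fin N, i < j → σ j = j) → ∀ e,
      Φ i (e ∘ σ) = (Perm.sign σ : ℤ) • Φ i e) :
    ∑ i ∈ Finset.range q, Φ i (fun j => expVec N Y j + if (j : ℕ) = i then d else 0) =
      ∑ Z ∈ diagramsLE N with (Y ≤ Z ∧ IsRibbon (Z.cells \ Y.cells)) ∧
          (Z.cells \ Y.cells).card = d ∧ tailRow (Z.cells \ Y.cells) < q,
        ribbonSign (Z.cells \ Y.cells) • Φ (tailRow (Z.cells \ Y.cells)) (expVec N Z) := by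
  symm
  -- Ribbons of size `d` inject into rows by their tails; the rows that are not hit must contribute
  -- zero.
  refine Finset.sum_of_injOn (fun Z => tailRow (Z.cells \ Y.cells)) ?_ ?_ ?_ ?_
  · intro Z hZ Z' hZ' heq
    simp only [Finset.coe_filter, mem_diagramsLE, Set.mem_ofPred_eq] at hZ hZ' heq
    obtain ⟨hZN, ⟨hYZ, hrib⟩, hcard, -⟩ := hZ
    obtain ⟨hZN', ⟨hYZ', hrib'⟩, hcard', -⟩ := hZ'
    obtain ⟨i₀, h⟩ := hrib.rows hYZ
    obtain ⟨i₀', h'⟩ := hrib'.rows hYZ'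
    have hc := (h.card_eq hZN).symm.trans (hcard.trans (hcard'.symm.trans (h'.card_eq hZN')))
    rw [← heq] at h' hc
    rcases le_total i₀ i₀' with hle | hle
    · exact h.eq_of_card_eq h' hle hc
    · exact (h'.eq_of_card_eq h hle hc.symm).symm
  · intro Z hZ
    simp only [Finset.coe_filter, mem_diagramsLE, Set.mem_ofPred_eq] at hZ
    simpa using hZ.2.2.2
  · intro i hi hni
    rw [Finset.mem_range] at hi
    rcases exists_ribbonRows hY hd (hi.trans_le hq) with ⟨j, hj, he⟩ | ⟨Z, i₀, h, hZN, hcard⟩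
    -- Swapping the two equal exponents moves nothing beyond `i`, so the term equals its own
    -- negative.
    · have hne : j ≠ ⟨i, hi.trans_le hq⟩ := fun h' => by simp [h'] at hj
      have h := hΦ i (Equiv.swap j ⟨i, hi.trans_le hq⟩) (fun k hk =>
        Equiv.swap_apply_of_ne_of_ne (fun h' => by rw [h'] at hk; omega)
          (fun h' => by simp [h'] at hk))
        (fun j => expVec N Y j + if (j : ℕ) = i then d else 0)
      rw [Perm.sign_swap hne, Units.val_neg, Units.val_one, neg_one_zsmul] at h
      rw [← self_eq_neg]
      convert h using 2
      ext k
      simp only [Function.comp_apply]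
      rcases eq_or_ne k j with rfl | hk
      · simp [hj.ne, he]
      rcases eq_or_ne k ⟨i, hi.trans_le hq⟩ with rfl | hk'
      · simp [hj.ne, he]
      · rw [Equiv.swap_apply_of_ne_of_ne hk hk']
    · exact absurd ⟨Z, by
        simp only [Finset.coe_filter, mem_diagramsLE, Set.mem_ofPred_eq]
        exact ⟨hZN, ⟨h.diagram_le, h.isRibbon⟩, hcard, h.tailRow_eq.symm ▸ hi⟩, h.tailRow_eq⟩ hni
  · intro Z hZ
    simp only [Finset.mem_filter, mem_diagramsLE] at hZ
    obtain ⟨hZN, ⟨hYZ, hrib⟩, hcard, -⟩ := hZ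
    obtain ⟨i₀, h⟩ := hrib.rows hYZ
    have h₁ := h.lt_of_card_le hZN
    have he : (fun j : Fin N => expVec N Y j +
        if (j : ℕ) = tailRow (Z.cells \ Y.cells) then d else 0) =
        expVec N Z ∘ Fin.cycleIcc ⟨i₀, h.le.trans_lt h₁⟩ ⟨tailRow (Z.cells \ Y.cells), h₁⟩ := by
      ext j
      rw [Function.comp_apply, h.expVec_cycleIcc h₁, ← h.card_eq hZN, hcard]
    rw [he, hΦ _ _ (fun j hj => Fin.cycleIcc_of_gt (by exact hj)), h.sign_cycleIcc h₁, ribbonSign]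
    simp

noncomputable section

/-! ### Antisymmetrization -/

section Antisymm

variable {κ : Type*} [Fintype κ] [DecidableEq κ]

/-- The antisymmetrization `∑_w sign(w) w` of a polynomial. -/
def antisymm : MvPolynomial κ ℂ →ₗ[ℂ] MvPolynomial κ ℂ :=
  ∑ w : Perm κ, (Perm.sign w : ℤ) • (MvPolynomial.rename w).toLinearMap

theorem antisymm_apply (P : MvPolynomial κ ℂ) :
    antisymm P = ∑ w : Perm κ, (Perm.sign w : ℤ) • MvPolynomial.rename w P := by
  simp [antisymm]

theorem antisymm_rename (σ : Perm κ) (P : MvPolynomial κ ℂ) :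
    antisymm (MvPolynomial.rename σ P) = (Perm.sign σ : ℤ) • antisymm P := by
  rw [antisymm_apply, antisymm_apply, Finset.smul_sum]
  refine Fintype.sum_equiv (Equiv.mulRight σ) _ _ fun w => ?_
  rw [Equiv.coe_mulRight, MvPolynomial.rename_rename, smul_smul, Perm.sign_mul, Units.val_mul,
    mul_left_comm, ← Units.val_mul (Perm.sign σ), Int.units_mul_self, Units.val_one, mul_one]
  rfl

theorem antisymm_mul_of_rename_eq (P Q : MvPolynomial κ ℂ)
    (hQ : ∀ w : Perm κ, MvPolynomial.rename w Q = Q) : antisymm (P * Q) = antisymm P * Q := by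
  simp_rw [antisymm_apply, map_mul, hQ, Finset.sum_mul, smul_mul_assoc]

/-- The monomial `x^e`. -/
def xpow (e : κ → ℕ) : MvPolynomial κ ℂ := ∏ j, MvPolynomial.X j ^ e j

omit [DecidableEq κ] in
theorem xpow_comp (σ : Perm κ) (e : κ → ℕ) :
    xpow (e ∘ σ) = MvPolynomial.rename (σ⁻¹ : Perm κ) (xpow e) := by
  simp only [xpow, map_prod, map_pow, MvPolynomial.rename_X, Function.comp_apply]
  rw [← Equiv.prod_comp σ fun x => MvPolynomial.X ((σ⁻¹ : Perm κ) x) ^ e x]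
  simp

omit [DecidableEq κ] in
theorem xpow_add (e e' : κ → ℕ) : xpow (fun j => e j + e' j) = xpow e * xpow e' := by
  simp only [xpow, pow_add, Finset.prod_mul_distrib]

/-- Invariance of `Q` is asked for this one permutation only, so that `Q` may be symmetric in just
some of the variables. -/
theorem antisymm_xpow_comp_mul (σ : Perm κ) (e : κ → ℕ) (Q : MvPolynomial κ ℂ)
    (hQ : MvPolynomial.rename (σ⁻¹ : Perm κ) Q = Q) :
    antisymm (xpow (e ∘ σ) * Q) = (Perm.sign σ : ℤ) • antisymm (xpow e * Q) := by
  rw [xpow_comp]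
  nth_rw 1 [← hQ]
  rw [← map_mul, antisymm_rename, Perm.sign_inv]

end Antisymm

/-! ### Colorings weighted by the factorials of the numbers of elements of each color -/

section Coloring

variable {ι κ : Type*} [Fintype ι] [DecidableEq ι] [Fintype κ] [DecidableEq κ] (m : ι → ℕ)

/-- The colorings of the elements of `S` by the elements of `A`. -/
def colorings (S : Finset ι) (A : Finset κ) : Finset (ι → Option κ) :=
  Fintype.piFinset fun s => if s ∈ S then A.map Function.Embedding.some else {none}

omit [Fintype κ] [DecidableEq κ] in
theorem mem_colorings {S : Finset ι} {A : Finset κ} {f : ι → Option κ} :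
    f ∈ colorings S A ↔ (∀ s ∈ S, ∃ v ∈ A, f s = some v) ∧ ∀ s ∉ S, f s = none := by
  rw [colorings, Fintype.mem_piFinset]
  constructor
  · intro h
    refine ⟨fun s hs => ?_, fun s hs => ?_⟩
    · have := h s
      rw [if_pos hs] at this
      obtain ⟨v, hv, e⟩ := Finset.mem_map.1 this
      exact ⟨v, hv, e.symm⟩
    · have := h s
      rw [if_neg hs] at this
      simpa using this
  · rintro ⟨h1, h2⟩ s
    split_ifs with hs
    · obtain ⟨v, hv, e⟩ := h1 s hs
      simp [e, hv]
    · simpa using h2 s hs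

/-- The weight of a coloring. -/
def colorWeight (f : ι → Option κ) : MvPolynomial κ ℂ :=
  (∏ v, ((Finset.univ.filter fun s => f s = some v).card.factorial : MvPolynomial κ ℂ)) *
    ∏ s, (f s).elim 1 fun v => MvPolynomial.X v ^ m s

/-- The sum of the weights of the colorings of `S` by `A`. -/
def colorSum (S : Finset ι) (A : Finset κ) : MvPolynomial κ ℂ :=
  ∑ f ∈ colorings S A, colorWeight m f

theorem colorSum_empty (A : Finset κ) : colorSum m ∅ A = 1 := by
  have : colorings (∅ : Finset ι) A = {fun _ => none} := by
    ext f
    simp [mem_colorings, funext_iff]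
  simp [colorSum, this, colorWeight]

theorem colorSum_empty_right {S : Finset ι} (hS : S.Nonempty) :
    colorSum m S (∅ : Finset κ) = 0 := by
  obtain ⟨s, hs⟩ := hS
  have : colorings S (∅ : Finset κ) = ∅ := by
    ext f
    simp only [mem_colorings, Finset.notMem_empty, false_and, exists_false, imp_false, iff_false]
    exact fun h => h.1 s hs
  rw [colorSum, this, Finset.sum_empty]

theorem rename_colorSum (σ : Perm κ) (S : Finset ι) (A : Finset κ) :
    MvPolynomial.rename σ (colorSum m S A) = colorSum m S (A.map σ.toEmbedding) := by
  rw [colorSum, map_sum]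
  refine Finset.sum_bij' (fun f _ s => (f s).map σ) (fun f _ s => (f s).map σ.symm) ?_ ?_ ?_ ?_ ?_
  · intro f hf
    rw [mem_colorings] at hf ⊢
    refine ⟨fun s hs => ?_, fun s hs => by rw [hf.2 s hs]; rfl⟩
    obtain ⟨v, hv, e⟩ := hf.1 s hs
    exact ⟨σ v, by simpa using hv, by rw [e]; rfl⟩
  · intro f hf
    rw [mem_colorings] at hf ⊢
    refine ⟨fun s hs => ?_, fun s hs => by rw [hf.2 s hs]; rfl⟩
    obtain ⟨v, hv, e⟩ := hf.1 s hs
    obtain ⟨u, hu, rfl⟩ := Finset.mem_map.1 hv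
    exact ⟨u, hu, by simp [e]⟩
  · intro f _
    funext s
    simp [Option.map_map]
  · intro f _
    funext s
    simp [Option.map_map]
  · intro f _
    rw [colorWeight, colorWeight, map_mul, map_prod, map_prod]
    congr 1
    · refine Fintype.prod_equiv σ _ _ fun v => ?_
      rw [map_natCast]
      congr 3
      ext s
      simp only [Finset.mem_filter, Finset.mem_univ, true_and]
      cases f s <;> simp
    · refine Finset.prod_congr rfl fun s _ => ?_
      cases f s <;> simp

/-- Uncoloring `s` lowers only the count `c` of color `i`, and `c! = c · (c - 1)!`. -/
theorem colorWeight_update {f : ι → Option κ} {s : ι} {i : κ} (hs : f s = some i) :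
    ((Finset.univ.filter fun s => f s = some i).card : MvPolynomial κ ℂ) *
      (MvPolynomial.X i ^ m s * colorWeight m (Function.update f s none)) = colorWeight m f := by
  have hcard : ∀ v, (Finset.univ.filter fun t => Function.update f s none t = some v).card =
      (Finset.univ.filter fun t => f t = some v).card - if v = i then 1 else 0 := by
    intro v
    have : (Finset.univ.filter fun t => Function.update f s none t = some v) =
        (Finset.univ.filter fun t => f t = some v).erase s := by
      ext t
      rcases eq_or_ne t s with rfl | ht <;> simp [*]
    rw [this]
    split_ifs with hv
    · exact Finset.card_erase_of_mem (by simp [hs, hv])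
    · rw [Finset.erase_eq_of_notMem (by simp [hs, Ne.symm hv]), Nat.sub_zero]
  have hpos : 0 < (Finset.univ.filter fun t => f t = some i).card :=
    Finset.card_pos.2 ⟨s, by simp [hs]⟩
  simp only [colorWeight, hcard]
  rw [← Finset.mul_prod_erase _ _ (Finset.mem_univ i),
    ← Finset.mul_prod_erase (a := i) (f := fun v =>
      ((Finset.univ.filter fun s => f s = some v).card.factorial : MvPolynomial κ ℂ)) _
      (Finset.mem_univ i),
    ← Finset.mul_prod_erase _ _ (Finset.mem_univ s),
    ← Finset.mul_prod_erase (a := s) (f := fun s => (f s).elim (1 : MvPolynomial κ ℂ)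
      fun v => MvPolynomial.X v ^ m s) _ (Finset.mem_univ s)]
  rw [Finset.prod_congr (s₁ := Finset.univ.erase i) rfl fun v hv => by
    rw [if_neg (Finset.ne_of_mem_erase hv), Nat.sub_zero]]
  rw [Finset.prod_congr (s₁ := Finset.univ.erase s) rfl fun t ht => by
    rw [Function.update_of_ne (Finset.ne_of_mem_erase ht)]]
  rw [if_pos rfl, hs, Function.update_self, ← Nat.mul_factorial_pred hpos.ne', Nat.cast_mul]
  simp only [Option.elim]
  ring

/-- Single out an element of color `i`, if there is one. -/
theorem colorSum_erase {S : Finset ι} {A : Finset κ} {i : κ} (hi : i ∈ A) :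
    colorSum m S A = colorSum m S (A.erase i) +
      ∑ s ∈ S, MvPolynomial.X i ^ m s * colorSum m (S.erase s) A := by
  have hsub : colorings S (A.erase i) ⊆ colorings S A := by
    intro f hf
    rw [mem_colorings] at hf ⊢
    exact ⟨fun s hs => (hf.1 s hs).imp fun v hv => ⟨Finset.mem_of_mem_erase hv.1, hv.2⟩, hf.2⟩
  have hterm : ∀ f ∈ colorings S A, colorWeight m f =
      (if f ∈ colorings S (A.erase i) then colorWeight m f else 0) +
        ∑ s ∈ S, if f s = some i then
          MvPolynomial.X i ^ m s * colorWeight m (Function.update f s none) else 0 := by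
    intro f hf
    have hiff : f ∈ colorings S (A.erase i) ↔ ∀ s ∈ S, f s ≠ some i := by
      rw [mem_colorings] at hf ⊢
      constructor
      · intro h s hs e
        obtain ⟨v, hv, e'⟩ := h.1 s hs
        rw [e, Option.some.injEq] at e'
        exact Finset.ne_of_mem_erase hv e'.symm
      · refine fun h => ⟨fun s hs => ?_, hf.2⟩
        obtain ⟨v, hv, e⟩ := hf.1 s hs
        exact ⟨v, Finset.mem_erase.2 ⟨fun h' => h s hs (h' ▸ e), hv⟩, e⟩
    split_ifs with h
    · rw [Finset.sum_eq_zero fun s hs => if_neg (hiff.1 h s hs), add_zero]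
    · rw [hiff] at h
      push Not at h
      obtain ⟨s₀, hs₀, e₀⟩ := h
      have hpos : ((Finset.univ.filter fun s => f s = some i).card : MvPolynomial κ ℂ) ≠ 0 := by
        rw [Nat.cast_ne_zero]
        exact (Finset.card_pos.2 ⟨s₀, by simp [e₀]⟩).ne'
      -- After multiplication by the number `c` of elements of color `i`, each of the `c` choices of
      -- `s` yields the full weight of `f`.
      apply mul_left_cancel₀ hpos
      rw [zero_add, Finset.mul_sum, ← Finset.sum_filter_add_sum_filter_not S (fun s => f s = some i)]
      rw [Finset.sum_congr (s₁ := S.filter fun s => f s = some i) rfl fun s hs => by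
        rw [if_pos (Finset.mem_filter.1 hs).2, colorWeight_update m (Finset.mem_filter.1 hs).2],
        Finset.sum_eq_zero (s := S.filter fun s => ¬ f s = some i) fun s hs => by
          rw [if_neg (Finset.mem_filter.1 hs).2, mul_zero], Finset.sum_const, nsmul_eq_mul,
        add_zero]
      congr 3
      ext s
      simp only [Finset.mem_filter, Finset.mem_univ, true_and]
      refine ⟨fun h => ⟨?_, h⟩, fun h => h.2⟩
      by_contra hs
      rw [(mem_colorings.1 hf).2 s hs] at h
      simp at h
  rw [colorSum, Finset.sum_congr rfl hterm, Finset.sum_add_distrib, Finset.sum_comm,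
    ← Finset.sum_filter, Finset.filter_mem_eq_inter, Finset.inter_eq_right.2 hsub]
  congr 1
  refine Finset.sum_congr rfl fun s hs => ?_
  rw [← Finset.sum_filter, colorSum, Finset.mul_sum]
  refine Finset.sum_bij' (fun f _ => Function.update f s none)
    (fun f _ => Function.update f s (some i)) ?_ ?_ ?_ ?_ fun _ _ => rfl
  · intro f hf
    rw [Finset.mem_filter, mem_colorings] at hf
    rw [mem_colorings]
    refine ⟨fun t ht => ?_, fun t ht => ?_⟩
    · rw [Function.update_of_ne (Finset.ne_of_mem_erase ht)]
      exact hf.1.1 t (Finset.mem_of_mem_erase ht)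
    · rcases eq_or_ne t s with rfl | hts
      · rw [Function.update_self]
      · rw [Function.update_of_ne hts]
        exact hf.1.2 t fun h => ht (Finset.mem_erase.2 ⟨hts, h⟩)
  · intro f hf
    rw [mem_colorings] at hf
    rw [Finset.mem_filter, mem_colorings]
    refine ⟨⟨fun t ht => ?_, fun t ht => ?_⟩, Function.update_self ..⟩
    · rcases eq_or_ne t s with rfl | hts
      · exact ⟨i, hi, Function.update_self ..⟩
      · rw [Function.update_of_ne hts]
        exact hf.1 t (Finset.mem_erase.2 ⟨hts, ht⟩)
    · have hts : t ≠ s := fun h => ht (h ▸ hs)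
      rw [Function.update_of_ne hts]
      exact hf.2 t fun h => ht (Finset.mem_of_mem_erase h)
  · intro f hf
    rw [Function.update_idem, ← (Finset.mem_filter.1 hf).2, Function.update_eq_self]
  · intro f hf
    rw [Function.update_idem, ← (mem_colorings.1 hf).2 s (Finset.notMem_erase s S),
      Function.update_eq_self]

/-- The first `q` of `N` variables. -/
def firstVars (N q : ℕ) : Finset (Fin N) := Finset.univ.filter fun j => (j : ℕ) < q

/-- Iterate `colorSum_erase` from the last color down: `i` is the largest color in use and `s` a
chosen element of that color. The other elements may still have color `i`, hence `i + 1`. -/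
theorem colorSum_firstVars {N q : ℕ} (hq : q ≤ N) {S : Finset ι} (hS : S.Nonempty) :
    colorSum m S (firstVars N q) = ∑ s ∈ S, ∑ i ∈ Finset.range q,
      xpow (fun j : Fin N => if (j : ℕ) = i then m s else 0) *
        colorSum m (S.erase s) (firstVars N (i + 1)) := by
  induction q with
  | zero =>
    have : firstVars N 0 = ∅ := by simp [firstVars]
    simp [this, colorSum_empty_right m hS]
  | succ q ih =>
    have hmem : (⟨q, hq⟩ : Fin N) ∈ firstVars N (q + 1) := by simp [firstVars]
    have herase : (firstVars N (q + 1)).erase ⟨q, hq⟩ = firstVars N q := by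
      ext j
      simp only [firstVars, Finset.mem_erase, Finset.mem_filter, Finset.mem_univ, true_and, ne_eq,
        Fin.ext_iff]
      omega
    rw [colorSum_erase m hmem, herase, ih (by omega)]
    simp_rw [Finset.sum_range_succ]
    rw [Finset.sum_add_distrib]
    congr 1
    refine Finset.sum_congr rfl fun s _ => ?_
    congr 1
    rw [xpow, Finset.prod_eq_single (⟨q, hq⟩ : Fin N)
      (fun j _ hj => by rw [if_neg fun h => hj (Fin.ext h), pow_zero]) (by simp), if_pos rfl]

theorem rename_colorSum_firstVars {N i : ℕ} {σ : Perm (Fin N)}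
    (hσ : ∀ j : Fin N, i < j → σ j = j) (S : Finset ι) :
    MvPolynomial.rename (σ⁻¹ : Perm (Fin N)) (colorSum m S (firstVars N (i + 1))) =
      colorSum m S (firstVars N (i + 1)) := by
  rw [rename_colorSum]
  congr 1
  refine Finset.eq_of_subset_of_card_le (fun j hj => ?_) (by rw [Finset.card_map])
  obtain ⟨k, hk, rfl⟩ := Finset.mem_map.1 hj
  simp only [firstVars, Finset.mem_filter, Finset.mem_univ, true_and, Equiv.coe_toEmbedding]
    at hk ⊢
  by_contra h
  have h1 := hσ _ (show i < ((σ⁻¹ k : Fin N) : ℕ) by omega)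
  rw [show σ ((σ⁻¹ : Perm (Fin N)) k) = k from σ.apply_symm_apply k] at h1
  rw [← h1] at h
  exact h hk

end Coloring

/-! ### Sums over ribbon tableaux -/

section Chain

variable {r : ℕ}

/-- The `i`-th difference of a sequence of diagrams. -/
def chainRibbon (c : Fin (r + 1) → YoungDiagram) (i : Fin r) : Finset (ℕ × ℕ) :=
  (c i.succ).cells \ (c i.castSucc).cells

/-- The sizes of the differences of a sequence of diagrams. -/
def chainType (c : Fin (r + 1) → YoungDiagram) : List ℕ :=
  List.ofFn fun i => (chainRibbon c i).card

/-- The product of the signs of the differences of a sequence of diagrams. -/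
def chainSign (c : Fin (r + 1) → YoungDiagram) : ℤ := ∏ i, ribbonSign (chainRibbon c i)

/-- The last rows of the differences decrease weakly and are less than `q`. -/
def TailsBelow (q : ℕ) (c : Fin (r + 1) → YoungDiagram) : Prop :=
  (Antitone fun i => tailRow (chainRibbon c i)) ∧ ∀ i, tailRow (chainRibbon c i) < q

variable (Y : YoungDiagram) (c : Fin (r + 1) → YoungDiagram)

theorem chainType_cons : chainType (Fin.cons Y c : Fin (r + 2) → YoungDiagram) =
    ((c 0).cells \ Y.cells).card :: chainType c := by
  rw [chainType, List.ofFn_succ]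
  rfl

theorem chainSign_cons : chainSign (Fin.cons Y c : Fin (r + 2) → YoungDiagram) =
    ribbonSign ((c 0).cells \ Y.cells) * chainSign c := by
  rw [chainSign, Fin.prod_univ_succ]
  rfl

/-- The bound `q` carries the state of the recursion. Later tails may share the row of the first
one, hence the `+ 1`, matching `colorSum_firstVars`. -/
theorem tailsBelow_cons (q : ℕ) : TailsBelow q (Fin.cons Y c : Fin (r + 2) → YoungDiagram) ↔
    tailRow ((c 0).cells \ Y.cells) < q ∧
      TailsBelow (tailRow ((c 0).cells \ Y.cells) + 1) c := by
  constructor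
  · rintro ⟨h1, h2⟩
    refine ⟨h2 0, fun i j hij => h1 (Fin.succ_le_succ_iff.2 hij), fun i => ?_⟩
    exact Nat.lt_succ_of_le (h1 (Fin.zero_le i.succ))
  · rintro ⟨h1, h2, h3⟩
    refine ⟨fun i j hij => ?_, fun i => ?_⟩
    · induction i using Fin.cases with
      | zero =>
        induction j using Fin.cases with
        | zero => exact le_rfl
        | succ j => exact Nat.le_of_lt_succ (h3 j)
      | succ i =>
        induction j using Fin.cases with
        | zero => exact absurd hij (by simp)
        | succ j => exact h2 (Fin.succ_le_succ_iff.1 hij)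
    · induction i using Fin.cases with
      | zero => exact h1
      | succ i => exact (Nat.le_of_lt_succ (h3 i)).trans_lt h1

end Chain

namespace RibbonTableau

variable {Y Z : YoungDiagram} {r : ℕ}

/-- Put a ribbon in front of a tableau. -/
def cons {X : YoungDiagram} (hXY : X ≤ Y) (h : IsRibbon (Y.cells \ X.cells))
    (T : RibbonTableau Y Z r) : RibbonTableau X Z (r + 1) where
  chain := Fin.cons X T.chain
  chain_zero := rfl
  chain_last := T.chain_last
  chain_le i := by
    induction i using Fin.cases with
    | zero => exact hXY.trans_eq T.chain_zero.symm
    | succ i => exact T.chain_le i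
  isRibbon i := by
    induction i using Fin.cases with
    | zero => rw [← T.chain_zero] at h; exact h
    | succ i => exact T.isRibbon i

/-- Remove the first ribbon of a tableau. -/
def tail (T : RibbonTableau Y Z (r + 1)) : RibbonTableau (T.chain 1) Z r where
  chain := Fin.tail T.chain
  chain_zero := rfl
  chain_last := T.chain_last
  chain_le i := T.chain_le i.succ
  isRibbon i := T.isRibbon i.succ

theorem cons_tail_chain (T : RibbonTableau Y Z (r + 1)) :
    (Fin.cons Y (Fin.tail T.chain) : Fin (r + 2) → YoungDiagram) = T.chain := by
  have h := Fin.cons_self_tail T.chain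
  rwa [T.chain_zero] at h

-- Letting `F` depend on the chain alone avoids transporting tableaux along equalities of their
-- inner shapes.
open Classical in
theorem sum_succ {R : Type*} [AddCommMonoid R] {N : ℕ} (hZ : Z.card ≤ N)
    (F : (Fin (r + 2) → YoungDiagram) → R) :
    ∑ T : RibbonTableau Y Z (r + 1), F T.chain =
      ∑ X ∈ diagramsLE N with Y ≤ X ∧ IsRibbon (X.cells \ Y.cells),
        ∑ T : RibbonTableau X Z r, F (Fin.cons Y T.chain) := by
  rw [Finset.sum_sigma']
  refine Finset.sum_bij (fun T _ => ⟨T.chain 1, T.tail⟩) ?_ ?_ ?_ ?_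
  · intro T _
    have h1 := T.chain_le 0
    have h2 := T.isRibbon 0
    rw [Fin.castSucc_zero, T.chain_zero] at h1 h2
    simp only [Finset.mem_sigma, Finset.mem_filter, mem_diagramsLE, Finset.mem_univ, and_true]
    exact ⟨(Finset.card_le_card (YoungDiagram.cells_subset_iff.2 (T.chain_le_shape 1))).trans hZ,
      h1, h2⟩
  · intro T _ T' _ h
    have h1 := congrArg (fun x : (X : YoungDiagram) × RibbonTableau X Z r =>
      (Fin.cons Y x.2.chain : Fin (r + 2) → YoungDiagram)) h
    simp only [tail, cons_tail_chain] at h1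
    exact RibbonTableau.ext h1
  · rintro ⟨X, T⟩ h
    simp only [Finset.mem_sigma, Finset.mem_filter, mem_diagramsLE, Finset.mem_univ,
      and_true] at h
    obtain ⟨C, rfl, rfl, h1, h2⟩ := T
    exact ⟨cons h.2.1 h.2.2 ⟨C, rfl, rfl, h1, h2⟩, Finset.mem_univ _, rfl⟩
  · intro T _
    simp only [tail, cons_tail_chain]

end RibbonTableau

/-! ### The Murnaghan–Nakayama rule -/

theorem sum_xpow_single (N d : ℕ) : MvPolynomial.psum (Fin N) ℂ d =
    ∑ i ∈ Finset.range N, xpow (fun j : Fin N => if (j : ℕ) = i then d else 0) := by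
  rw [MvPolynomial.psum, Finset.sum_range]
  refine Finset.sum_congr rfl fun i _ => ?_
  rw [xpow, Finset.prod_eq_single i (fun j _ hj => by
    rw [if_neg fun h => hj (Fin.ext h), pow_zero]) (by simp), if_pos rfl]

theorem sum_tableau_zero {R : Type*} [AddCommGroup R] {N : ℕ} {Y : YoungDiagram} (hY : Y.card ≤ N)
    (P : (Fin 1 → YoungDiagram) → ℤ) (hP : P (fun _ => Y) = 1) (a : YoungDiagram → R) :
    ∑ Z ∈ diagramsLE N, (∑ T : RibbonTableau Y Z 0, P T.chain) • a Z = a Y := by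
  rw [Finset.sum_eq_single Y]
  · have hone : ∀ T : RibbonTableau Y Y 0, T.chain = fun _ => Y := fun T =>
      funext fun i => by rw [Fin.eq_zero i, T.chain_zero]
    let T₀ : RibbonTableau Y Y 0 := ⟨fun _ => Y, rfl, rfl, fun i => i.elim0, fun i => i.elim0⟩
    rw [Fintype.sum_eq_single T₀ fun T hT => (hT (RibbonTableau.ext (hone T))).elim, hP, one_smul]
  · intro Z _ hZ
    have : IsEmpty (RibbonTableau Y Z 0) :=
      ⟨fun T => hZ (T.chain_last.symm.trans (T.chain_zero))⟩
    rw [Finset.univ_eq_empty, Finset.sum_empty, zero_smul]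
  · exact fun h => (h (mem_diagramsLE.2 hY)).elim

open Classical in
/-- Expansion of a sum over tableaux along the first ribbon. -/
theorem sum_tableau_succ {R : Type*} [AddCommGroup R] {N r : ℕ} {Y : YoungDiagram}
    (P : (Fin (r + 2) → YoungDiagram) → Prop) [DecidablePred P] (a : YoungDiagram → R) :
    ∑ Z ∈ diagramsLE N, (∑ T : RibbonTableau Y Z (r + 1),
        if P T.chain then chainSign T.chain else 0) • a Z =
      ∑ X ∈ diagramsLE N with Y ≤ X ∧ IsRibbon (X.cells \ Y.cells),
        ribbonSign (X.cells \ Y.cells) • ∑ Z ∈ diagramsLE N, (∑ T : RibbonTableau X Z r,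
          if P (Fin.cons Y T.chain) then chainSign T.chain else 0) • a Z := by
  simp_rw [Finset.smul_sum]
  rw [Finset.sum_comm]
  refine Finset.sum_congr rfl fun Z hZ => ?_
  rw [RibbonTableau.sum_succ (mem_diagramsLE.1 hZ) fun c => if P c then chainSign c else 0,
    Finset.sum_smul]
  refine Finset.sum_congr rfl fun X _ => ?_
  rw [smul_smul, Finset.mul_sum]
  congr 1
  refine Finset.sum_congr rfl fun T _ => ?_
  rw [chainSign_cons, T.chain_zero, mul_ite, mul_zero]

theorem card_eq_add_of_le {X Y : YoungDiagram} (h : Y ≤ X) :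
    X.card = Y.card + (X.cells \ Y.cells).card :=
  (Finset.card_sdiff_add_card_eq_card (YoungDiagram.cells_subset_iff.2 h)).symm.trans
    (add_comm _ _)

theorem tailRow_lt {N : ℕ} {X Y : YoungDiagram} (h : Y ≤ X) (hr : IsRibbon (X.cells \ Y.cells))
    (hX : X.card ≤ N) : tailRow (X.cells \ Y.cells) < N := by
  obtain ⟨i₀, h⟩ := hr.rows h
  exact h.lt_of_card_le hX

-- Each factor `p_d` lengthens every row in turn, so `sum_lengthen_row` applies with `q = N`, which
-- puts no restriction on the tails. The remaining factors are symmetric and pass through the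
-- antisymmetrization.
open Classical in
theorem antisymm_mul_psum_prod {N : ℕ} (l : List ℕ) (hl : ∀ d ∈ l, 0 < d) (Y : YoungDiagram)
    (hY : Y.card + l.sum ≤ N) :
    antisymm (xpow (expVec N Y) * (l.map (MvPolynomial.psum (Fin N) ℂ)).prod) =
      ∑ Z ∈ diagramsLE N, (∑ T : RibbonTableau Y Z l.length,
        if chainType T.chain = l then chainSign T.chain else 0) •
          antisymm (xpow (expVec N Z)) := by
  induction l generalizing Y with
  | nil =>
    rw [List.map_nil, List.prod_nil, mul_one]
    refine (sum_tableau_zero (by simpa using hY)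
      (fun c => if chainType c = ([] : List ℕ) then chainSign c else 0) ?_
      fun Z => antisymm (xpow (expVec N Z))).symm
    simp [chainType, chainSign]
  | cons d l ih =>
    rw [List.sum_cons] at hY
    have hsymm : ∀ w : Perm (Fin N), MvPolynomial.rename w
        (l.map (MvPolynomial.psum (Fin N) ℂ)).prod =
          (l.map (MvPolynomial.psum (Fin N) ℂ)).prod := by
      intro w
      rw [map_list_prod, List.map_map]
      congr 2
      funext e
      exact MvPolynomial.psum_isSymmetric (Fin N) ℂ e w
    have hstep := sum_lengthen_row (R := MvPolynomial (Fin N) ℂ) (q := N)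
      (show Y.card + d ≤ N by omega)
      (hl d List.mem_cons_self) le_rfl (fun _ e => antisymm (xpow e))
      fun i σ _ e => by
        simpa using antisymm_xpow_comp_mul σ e (1 : MvPolynomial (Fin N) ℂ) (map_one _)
    rw [List.map_cons, List.prod_cons, ← mul_assoc, antisymm_mul_of_rename_eq _ _ hsymm,
      sum_xpow_single, Finset.mul_sum, map_sum]
    simp_rw [← xpow_add]
    rw [hstep, Finset.sum_mul]
    refine Eq.trans ?_ (sum_tableau_succ (fun c => chainType c = d :: l) _).symm
    rw [Finset.sum_filter, Finset.sum_filter]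
    refine Finset.sum_congr rfl fun X hX => ?_
    rw [mem_diagramsLE] at hX
    by_cases hYX : Y ≤ X ∧ IsRibbon (X.cells \ Y.cells)
    · rw [if_pos hYX]
      by_cases hd : (X.cells \ Y.cells).card = d
      · rw [if_pos ⟨hYX, hd, tailRow_lt hYX.1 hYX.2 hX⟩, smul_mul_assoc,
          ← antisymm_mul_of_rename_eq _ _ hsymm,
          ih (fun e he => hl e (List.mem_cons_of_mem _ he)) X
            (by rw [card_eq_add_of_le hYX.1]; omega)]
        congr 1
        refine Finset.sum_congr rfl fun Z _ => ?_
        congr 1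
        refine Finset.sum_congr rfl fun T _ => ?_
        rw [chainType_cons, T.chain_zero, hd]
        simp
      · rw [if_neg fun h => hd h.2.1]
        symm
        apply smul_eq_zero_of_right
        refine Finset.sum_eq_zero fun Z _ => ?_
        rw [Finset.sum_eq_zero, zero_smul]
        intro T _
        rw [chainType_cons, T.chain_zero, if_neg]
        simp [hd]
    · rw [if_neg hYX, if_neg fun h => hYX h.1]

/-! ### The path Murnaghan–Nakayama rule -/

/-- The product of the factorials of the multiplicities of a multiset. -/
def countFactorial (M : Multiset ℕ) : ℕ := ∏ i ∈ M.toFinset, (M.count i).factorial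

theorem countFactorial_erase {M : Multiset ℕ} {d : ℕ} (hd : d ∈ M) :
    M.count d * countFactorial (M.erase d) = countFactorial M := by
  have h : countFactorial (M.erase d) = ∏ i ∈ M.toFinset, ((M.erase d).count i).factorial :=
    Finset.prod_subset
      (Multiset.toFinset_subset.2 (Multiset.subset_of_le (Multiset.erase_le d M))) fun i _ hi => by
        rw [Multiset.mem_toFinset] at hi
        rw [Multiset.count_eq_zero_of_notMem hi, Nat.factorial_zero]
  rw [h, countFactorial, ← Finset.mul_prod_erase _ _ (Multiset.mem_toFinset.2 hd),
    ← Finset.mul_prod_erase (a := d) (f := fun i => (M.count i).factorial) _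
      (Multiset.mem_toFinset.2 hd), ← mul_assoc, Multiset.count_erase_self,
    Nat.mul_factorial_pred (Multiset.count_pos.2 hd).ne']
  congr 1
  refine Finset.prod_congr rfl fun i hi => ?_
  rw [Multiset.count_erase_of_ne (Finset.ne_of_mem_erase hi)]

variable {ι : Type*} [Fintype ι] [DecidableEq ι]

-- Induction on the number of ribbons along `colorSum_firstVars`. The diagram `Y` and the bound `q`
-- vary, because the remaining elements start from the enlarged diagram and use only the colors up
-- to the last tail row.
open Classical in
theorem antisymm_mul_colorSum {N : ℕ} (m : ι → ℕ) (hm : ∀ s, 0 < m s) (r : ℕ) (S : Finset ι)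
    (hS : S.card = r) (q : ℕ) (hq : q ≤ N) (Y : YoungDiagram) (hY : Y.card + ∑ s ∈ S, m s ≤ N) :
    antisymm (xpow (expVec N Y) * colorSum m S (firstVars N q)) =
      countFactorial (S.val.map m) • ∑ Z ∈ diagramsLE N, (∑ T : RibbonTableau Y Z r,
        if TailsBelow q T.chain ∧ (chainType T.chain : Multiset ℕ) = S.val.map m
          then chainSign T.chain else 0) • antisymm (xpow (expVec N Z)) := by
  induction r generalizing S q Y with
  | zero =>
    obtain rfl := Finset.card_eq_zero.1 hS
    rw [colorSum_empty, mul_one]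
    rw [sum_tableau_zero (by simpa using hY) (fun c => if TailsBelow q c ∧
      (chainType c : Multiset ℕ) = (∅ : Finset ι).val.map m then chainSign c else 0) ?_
      fun Z => antisymm (xpow (expVec N Z))]
    · simp [countFactorial]
    · rw [if_pos]
      · simp [chainSign]
      · exact ⟨⟨fun i => i.elim0, fun i => i.elim0⟩, by simp [chainType]⟩
  | succ r ih =>
    have hne : S.Nonempty := Finset.card_pos.1 (by omega)
    set M := S.val.map m with hM
    -- The contribution of a first ribbon of size `d`; it depends on the chosen element only through
    -- its size.
    set K : ℕ → MvPolynomial (Fin N) ℂ := fun d =>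
      ∑ X ∈ diagramsLE N with (Y ≤ X ∧ IsRibbon (X.cells \ Y.cells)) ∧
          (X.cells \ Y.cells).card = d ∧ tailRow (X.cells \ Y.cells) < q,
        ribbonSign (X.cells \ Y.cells) • ∑ Z ∈ diagramsLE N, (∑ T : RibbonTableau X Z r,
          if TailsBelow (tailRow (X.cells \ Y.cells) + 1) T.chain ∧
            (chainType T.chain : Multiset ℕ) = M.erase d
          then chainSign T.chain else 0) • antisymm (xpow (expVec N Z)) with hK
    have hleft : antisymm (xpow (expVec N Y) * colorSum m S (firstVars N q)) =
        ∑ s ∈ S, countFactorial (M.erase (m s)) • K (m s) := by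
      rw [colorSum_firstVars m hq hne, Finset.mul_sum, map_sum]
      refine Finset.sum_congr rfl fun s hs => ?_
      have hsum := Finset.add_sum_erase S m hs
      have hMs : (S.erase s).val.map m = M.erase (m s) := by
        rw [hM, Finset.erase_val, Multiset.map_erase_of_mem _ _ hs]
      rw [Finset.mul_sum, map_sum]
      simp_rw [← mul_assoc, ← xpow_add]
      rw [sum_lengthen_row (show Y.card + m s ≤ N by omega) (hm s) hq
        (fun i e => antisymm (xpow e * colorSum m (S.erase s) (firstVars N (i + 1))))
        fun i σ hσ e => antisymm_xpow_comp_mul σ e _ (rename_colorSum_firstVars m hσ _), hK,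
        Finset.smul_sum]
      refine Finset.sum_congr rfl fun X hX => ?_
      obtain ⟨hXN, ⟨hYX, hrib⟩, hcard, hlt⟩ := Finset.mem_filter.1 hX
      rw [smul_comm (countFactorial _), ih (S.erase s) (by rw [Finset.card_erase_of_mem hs]; omega)
        _ (by omega) X (by rw [card_eq_add_of_le hYX]; omega), hMs]
    -- The `M.count d` elements of size `d` give equal terms, and this count completes the factorial
    -- product.
    have hcount : ∑ s ∈ S, countFactorial (M.erase (m s)) • K (m s) =
        countFactorial M • ∑ d ∈ M.toFinset, K d := by
      have := Finset.sum_multiset_map_count M fun d => countFactorial (M.erase d) • K d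
      rw [hM, Multiset.map_map, ← hM] at this
      refine Eq.trans this ?_
      rw [Finset.smul_sum]
      refine Finset.sum_congr rfl fun d hd => ?_
      rw [smul_smul, countFactorial_erase (Multiset.mem_toFinset.1 hd)]
    rw [hleft, hcount, sum_tableau_succ (fun c => TailsBelow q c ∧
      (chainType c : Multiset ℕ) = M)]
    congr 1
    rw [Finset.sum_filter]
    simp_rw [hK, Finset.sum_filter]
    rw [Finset.sum_comm]
    refine Finset.sum_congr rfl fun X hX => ?_
    by_cases hYX : Y ≤ X ∧ IsRibbon (X.cells \ Y.cells)
    swap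
    · rw [if_neg hYX]
      exact Finset.sum_eq_zero fun d _ => if_neg fun h => hYX h.1
    rw [if_pos hYX]
    have hcond : ∀ c : Fin (r + 1) → YoungDiagram, c 0 = X →
        ((TailsBelow q (Fin.cons Y c : Fin (r + 2) → YoungDiagram) ∧
          (chainType (Fin.cons Y c : Fin (r + 2) → YoungDiagram) : Multiset ℕ) = M) ↔
        (tailRow (X.cells \ Y.cells) < q ∧ (X.cells \ Y.cells).card ∈ M) ∧
          TailsBelow (tailRow (X.cells \ Y.cells) + 1) c ∧
            (chainType c : Multiset ℕ) = M.erase (X.cells \ Y.cells).card) := by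
      intro c hc
      rw [tailsBelow_cons, chainType_cons, hc, ← Multiset.cons_coe]
      constructor
      · rintro ⟨⟨h1, h2⟩, h3⟩
        rw [← h3]
        simp [h1, h2]
      · rintro ⟨⟨h1, h2⟩, h3, h4⟩
        exact ⟨⟨h1, h3⟩, by rw [h4, Multiset.cons_erase h2]⟩
    by_cases hgood : tailRow (X.cells \ Y.cells) < q ∧ (X.cells \ Y.cells).card ∈ M
    · rw [Finset.sum_eq_single (X.cells \ Y.cells).card
        (fun d _ hd => if_neg fun h => hd h.2.1.symm)
        fun h => (h (Multiset.mem_toFinset.2 hgood.2)).elim, if_pos ⟨hYX, rfl, hgood.1⟩]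
      congr 1
      refine Finset.sum_congr rfl fun Z _ => ?_
      congr 1
      refine Finset.sum_congr rfl fun T _ => if_congr ?_ rfl rfl
      rw [hcond _ T.chain_zero]
      simp [hgood]
    · refine (Finset.sum_eq_zero fun d hd => ?_).trans (Eq.symm ?_)
      · refine if_neg ?_
        rintro ⟨-, rfl, h⟩
        exact hgood ⟨h, Multiset.mem_toFinset.1 hd⟩
      apply smul_eq_zero_of_right
      refine Finset.sum_eq_zero fun Z _ => ?_
      rw [Finset.sum_eq_zero, zero_smul]
      intro T _
      exact if_neg fun h => hgood ((hcond _ T.chain_zero).1 h).1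

/-! ### Colorings that are constant on the classes of an equivalence relation -/

section Classes

open Classical in
/-- The set of the elements of a class. -/
def classOf {α : Type*} [Fintype α] {r : Setoid α} (q : Quotient r) : Finset α :=
  Finset.univ.filter fun x => (⟦x⟧ : Quotient r) = q

variable {α κ : Type*} [Fintype α] [Fintype κ] {r : Setoid α}

@[simp]
theorem mem_classOf {q : Quotient r} {x : α} : x ∈ classOf q ↔ (⟦x⟧ : Quotient r) = q := by
  simp [classOf]

open Classical in
omit [Fintype κ] in
theorem prod_X_comp_mk (h : Quotient r → κ) :
    ∏ x, (MvPolynomial.X (h ⟦x⟧) : MvPolynomial κ ℂ) =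
      ∏ q, MvPolynomial.X (h q) ^ (classOf q).card := by
  rw [← Finset.prod_fiberwise Finset.univ fun x => (⟦x⟧ : Quotient r)]
  refine Finset.prod_congr rfl fun q _ => ?_
  rw [Finset.prod_congr rfl fun x hx => by rw [(Finset.mem_filter.1 hx).2], Finset.prod_const]
  rfl

open Classical in
theorem sum_const_on_classes {R : Type*} [AddCommMonoid R] (F : (α → κ) → R) :
    ∑ g : α → κ with ∀ x y, r x y → g x = g y, F g =
      ∑ h : Quotient r → κ, F fun x => h ⟦x⟧ := by
  symm
  refine Finset.sum_bij (fun h _ x => h ⟦x⟧) ?_ ?_ ?_ fun _ _ => rfl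
  · intro h _
    simp only [Finset.mem_filter, Finset.mem_univ, true_and]
    intro x y hxy
    rw [Quotient.sound hxy]
  · intro h _ h' _ e
    funext q
    induction q using Quotient.inductionOn with
    | h x => exact congrFun e x
  · intro g hg
    exact ⟨Quotient.lift g (Finset.mem_filter.1 hg).2, Finset.mem_univ _, rfl⟩

open Classical in
theorem sum_prod_X_const_on_classes :
    ∑ g : α → κ with ∀ x y, r x y → g x = g y, ∏ x, (MvPolynomial.X (g x) : MvPolynomial κ ℂ) =
      ∏ q : Quotient r, MvPolynomial.psum κ ℂ (classOf q).card := by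
  rw [sum_const_on_classes fun g => ∏ x, (MvPolynomial.X (g x) : MvPolynomial κ ℂ)]
  simp_rw [prod_X_comp_mk, MvPolynomial.psum]
  rw [Finset.prod_univ_sum, Fintype.piFinset_univ]

end Classes

/-! ### Colorings that are invariant under a permutation -/

section Invariant

variable {α : Type*} [Fintype α] [DecidableEq α]

theorem prod_classOf_sameCycle {R : Type*} [CommMonoid R] (w : Perm α) (φ : ℕ → R)
    [Fintype (Quotient (Perm.SameCycle.setoid w))] :
    ∏ q : Quotient (Perm.SameCycle.setoid w), φ (classOf q).card =
      (w.partition.parts.map φ).prod := by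
  classical
  have hclass : ∀ x y, y ∈ classOf (⟦x⟧ : Quotient (Perm.SameCycle.setoid w)) ↔
      w.SameCycle x y := by
    intro x y
    rw [mem_classOf, Quotient.eq]
    exact Perm.sameCycle_comm
  -- Classes inside the support correspond to the cycle factors of `w`, the other classes to fixed
  -- points, which are the parts `1` of the partition.
  rw [← Finset.prod_filter_mul_prod_filter_not Finset.univ
    (fun q : Quotient (Perm.SameCycle.setoid w) => ∃ x ∈ w.support, ⟦x⟧ = q), Perm.parts_partition,
    Multiset.map_add, Multiset.prod_add, Multiset.map_replicate, Multiset.prod_replicate,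
    ← Finset.card_compl, Perm.cycleType_def, Multiset.map_map]
  congr 1
  · refine Finset.prod_bij (fun q _ => Quotient.lift w.cycleOf
      (fun x y h => Perm.SameCycle.cycleOf_eq h) q)
      ?_ ?_ ?_ ?_
    · intro q hq
      obtain ⟨x, hx, rfl⟩ := (Finset.mem_filter.1 hq).2
      exact Perm.cycleOf_mem_cycleFactorsFinset_iff.2 hx
    · intro q hq q' hq' h
      obtain ⟨x, hx, rfl⟩ := (Finset.mem_filter.1 hq).2
      obtain ⟨y, hy, rfl⟩ := (Finset.mem_filter.1 hq').2
      have h' : w.cycleOf x = w.cycleOf y := h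
      have := (Perm.mem_support_cycleOf_iff (f := w) (x := x) (y := x)).2 ⟨.refl _ _, hx⟩
      rw [h'] at this
      exact Quotient.sound (Perm.mem_support_cycleOf_iff.1 this).1.symm
    · intro c hc
      obtain ⟨x, hx⟩ := (Perm.mem_cycleFactorsFinset_iff.1 hc).1.nonempty_support
      have hxw := Perm.mem_cycleFactorsFinset_support_le hc hx
      exact ⟨⟦x⟧, Finset.mem_filter.2 ⟨Finset.mem_univ _, x, hxw, rfl⟩,
        (Perm.cycle_is_cycleOf hx hc).symm⟩
    · intro q hq
      obtain ⟨x, hx, rfl⟩ := (Finset.mem_filter.1 hq).2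
      simp only [Quotient.lift_mk, Function.comp_apply]
      congr 2
      ext y
      rw [hclass, Perm.mem_support_cycleOf_iff]
      exact ⟨fun h => ⟨h, hx⟩, fun h => h.1⟩
  · rw [← Finset.prod_const]
    symm
    refine Finset.prod_bij (fun x _ => ⟦x⟧) ?_ ?_ ?_ ?_
    · intro x hx
      simp only [Finset.mem_filter, Finset.mem_univ, true_and, not_exists, not_and]
      intro y hy h
      have := Quotient.exact h
      exact Finset.mem_compl.1 hx ((Perm.SameCycle.mem_support_iff this).1 hy)
    · intro x hx y _ h
      have h : w.SameCycle x y := Quotient.exact h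
      exact h.eq_of_left (Perm.notMem_support.1 (Finset.mem_compl.1 hx))
    · intro q hq
      induction q using Quotient.inductionOn with
      | h x =>
        refine ⟨x, Finset.mem_compl.2 fun hx => (Finset.mem_filter.1 hq).2 ⟨x, hx, rfl⟩, rfl⟩
    · intro x hx
      congr 1
      symm
      rw [Finset.card_eq_one]
      refine ⟨x, ?_⟩
      ext y
      rw [hclass, Finset.mem_singleton]
      refine ⟨fun h => (h.eq_of_left (Perm.notMem_support.1 (Finset.mem_compl.1 hx))).symm, ?_⟩
      rintro rfl
      exact .refl _ _

/-- The power sum indexed by the cycle type of a permutation enumerates the invariant colorings. -/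
theorem prod_psum_partition {κ : Type*} [Fintype κ] [DecidableEq κ] (w : Perm α) :
    (w.partition.parts.map (MvPolynomial.psum κ ℂ)).prod =
      ∑ g : α → κ with g ∘ w = g, ∏ x, (MvPolynomial.X (g x) : MvPolynomial κ ℂ) := by
  classical
  rw [← prod_classOf_sameCycle, ← sum_prod_X_const_on_classes]
  refine Finset.sum_congr ?_ fun _ _ => rfl
  ext g
  simp only [Finset.mem_filter, Finset.mem_univ, true_and]
  constructor
  · intro h
    funext x
    exact (h x (w x) ⟨1, by simp⟩).symm
  · intro h x y hxy
    obtain ⟨i, -, rfl⟩ := Perm.SameCycle.exists_pow_eq' hxy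
    clear hxy
    induction i with
    | zero => rfl
    | succ i ih =>
      rw [ih, pow_succ', Perm.mul_apply]
      exact (congrFun h _).symm

end Invariant

/-! ### Permutations that extend a given partial permutation and leave a coloring invariant -/

section Extension

variable {α β κ : Type*} [Fintype α] [DecidableEq α] [Fintype β] [Fintype κ] [DecidableEq κ]
  (I J : β ↪ α)

-- Extend the partial injection within each color class separately and glue.
omit [Fintype α] [DecidableEq α] [Fintype κ] [DecidableEq κ] in
theorem exists_perm_extending {g : α → κ} (hg : ∀ p, g (I p) = g (J p)) :
    ∃ w : Perm α, (∀ p, w (I p) = J p) ∧ ∀ x, g (w x) = g x := by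
  have h : ∀ v : κ, ∃ e : Perm {x // g x = v}, ∀ p : {p // g (I p) = v},
      e ⟨I p, p.2⟩ = ⟨J p, (hg p).symm.trans p.2⟩ := by
    intro v
    exact Perm.exists_extending_pair
      (fun p : {p // g (I p) = v} => (⟨I p, p.2⟩ : {x // g x = v}))
      (fun p => ⟨J p, (hg p).symm.trans p.2⟩)
      (fun p q h => Subtype.ext (I.injective (congrArg Subtype.val h)))
      fun p q h => Subtype.ext (J.injective (congrArg Subtype.val h))
  choose e he using h
  refine ⟨(Equiv.sigmaFiberEquiv g).symm.trans ((Equiv.sigmaCongrRight e).trans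
    (Equiv.sigmaFiberEquiv g)), fun p => ?_, fun x => ?_⟩
  · have := he (g (I p)) ⟨p, rfl⟩
    exact congrArg Subtype.val this
  · exact (e (g x) ⟨x, rfl⟩).2

-- Relative to one such extension `w₀`, the others are the `w₀ * u` with `u` a color-preserving
-- permutation of the complement of the range of `I`; these form a product of symmetric groups.
open Classical in
theorem card_perm_extending {g : α → κ} (hg : ∀ p, g (I p) = g (J p)) :
    (Finset.univ.filter fun w : Perm α => (∀ p, w (I p) = J p) ∧ g ∘ w = g).card =
      ∏ v, (Finset.univ.filter fun x => x ∉ Set.range I ∧ g x = v).card.factorial := by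
  obtain ⟨w₀, hw₀, hgw₀⟩ := exists_perm_extending I J hg
  have hcard : (Finset.univ.filter fun w : Perm α => (∀ p, w (I p) = J p) ∧ g ∘ w = g).card =
      Fintype.card {u : Perm {x // x ∉ Set.range I} // (fun x => g x.1) ∘ u = fun x => g x.1} := by
    rw [Fintype.card_subtype]
    symm
    refine Finset.card_bij (fun u _ => w₀ * Perm.ofSubtype u) ?_ ?_ ?_
    · intro u hu
      simp only [Finset.mem_filter, Finset.mem_univ, true_and] at hu ⊢
      refine ⟨fun p => ?_, funext fun x => ?_⟩
      · rw [Perm.mul_apply, Perm.ofSubtype_apply_of_not_mem u (by simp), hw₀]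
      · rw [Function.comp_apply, Perm.mul_apply, hgw₀]
        by_cases hx : x ∉ Set.range I
        · rw [Perm.ofSubtype_apply_of_mem u hx]
          exact congrFun hu ⟨x, hx⟩
        · rw [Perm.ofSubtype_apply_of_not_mem u hx]
    · intro u _ u' _ h
      exact Perm.ofSubtype_injective (mul_left_cancel h)
    · intro w hw
      simp only [Finset.mem_filter, Finset.mem_univ, true_and] at hw
      have hfix : ∀ x, ¬ x ∉ Set.range I → (w₀⁻¹ * w) x = x := by
        intro x hx
        obtain ⟨p, rfl⟩ := not_not.1 hx
        rw [Perm.mul_apply, hw.1, Perm.inv_eq_iff_eq, hw₀]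
      obtain ⟨u, hu⟩ := (Perm.subtypeEquivSubtypePerm fun x => x ∉ Set.range I).surjective
        ⟨w₀⁻¹ * w, hfix⟩
      have hu : Perm.ofSubtype u = w₀⁻¹ * w := congrArg Subtype.val hu
      refine ⟨u, ?_, by rw [hu, mul_inv_cancel_left]⟩
      simp only [Finset.mem_filter, Finset.mem_univ, true_and]
      funext x
      have hx : ((u x : {x // x ∉ Set.range I}) : α) = (w₀⁻¹ * w) x := by
        rw [← hu, Perm.ofSubtype_apply_coe]
      rw [Function.comp_apply, hx, ← hgw₀, Perm.mul_apply]
      rw [show w₀ ((w₀⁻¹ : Perm α) (w x)) = w x from w₀.apply_symm_apply _]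
      exact congrFun hw.2 x
  rw [hcard, DomMulAct.stabilizer_card]
  refine Finset.prod_congr rfl fun v _ => ?_
  rw [← Fintype.card_subtype, Fintype.card_congr (Equiv.subtypeSubtypeEquivSubtypeInter
    (fun x => x ∉ Set.range I) fun x => g x = v)]

end Extension

/-! ### The components of the graph of a partial permutation -/

section Components

variable {n k : ℕ} (I J : Fin k ↪ Fin n)

/-- Being in the same component of `G(I, J)`. -/
def edgeSetoid : Setoid (Fin n) := Relation.EqvGen.setoid (Edge I J)

theorem components_eq : open Classical in
    components I J = Finset.univ.image (classOf (r := edgeSetoid I J)) := by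
  classical
  have h : ∀ v, (Finset.univ.filter fun u => Relation.EqvGen (Edge I J) v u) =
      classOf (⟦v⟧ : Quotient (edgeSetoid I J)) := by
    intro v
    ext u
    rw [mem_classOf, Quotient.eq, Finset.mem_filter]
    exact ⟨fun h => h.2.symm, fun h => ⟨Finset.mem_univ _, h.symm⟩⟩
  ext C
  simp only [components, Finset.mem_image, Finset.mem_univ, true_and]
  constructor
  · rintro ⟨v, rfl⟩
    exact ⟨⟦v⟧, (h v).symm.trans (by congr)⟩
  · rintro ⟨q, rfl⟩
    induction q using Quotient.inductionOn with
    | h v => exact ⟨v, Eq.trans (by congr) (h v)⟩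

variable {I J}

theorem classOf_injective {α : Type*} [Fintype α] {r : Setoid α} :
    Function.Injective (classOf (r := r)) := by
  intro q q' h
  induction q using Quotient.inductionOn with
  | h x =>
    have : x ∈ classOf (⟦x⟧ : Quotient r) := by simp
    rw [h, mem_classOf] at this
    exact this

theorem mem_classOf_of_edge {q : Quotient (edgeSetoid I J)} {u v : Fin n} (h : Edge I J u v) :
    u ∈ classOf q ↔ v ∈ classOf q := by
  rw [mem_classOf, mem_classOf]
  have : (⟦u⟧ : Quotient (edgeSetoid I J)) = ⟦v⟧ := Quotient.sound (.rel _ _ h)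
  rw [this]

/-- Recognize a component from an enumeration of its vertices. -/
theorem exists_enumeration {c : ℕ → Fin n} {s : ℕ} (hs : 0 < s)
    (hinj : ∀ x < s, ∀ y < s, c x = c y → x = y)
    (hstep : ∀ x, x + 1 < s → Edge I J (c x) (c (x + 1)))
    (hout : ∀ x < s, ∀ u, Edge I J (c x) u → ∃ y < s, c y = u)
    (hin : ∀ x < s, ∀ u, Edge I J u (c x) → ∃ y < s, c y = u) :
    (∀ u, u ∈ classOf (⟦c 0⟧ : Quotient (edgeSetoid I J)) ↔ ∃ y < s, c y = u) ∧
      (classOf (⟦c 0⟧ : Quotient (edgeSetoid I J))).card = s ∧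
      ∃ v : Fin (classOf (⟦c 0⟧ : Quotient (edgeSetoid I J))).card ≃
        classOf (⟦c 0⟧ : Quotient (edgeSetoid I J)), ∀ x, (v x : Fin n) = c x := by
  have hmem : ∀ u, u ∈ classOf (⟦c 0⟧ : Quotient (edgeSetoid I J)) ↔ ∃ y < s, c y = u := by
    intro u
    constructor
    · intro hu
      have h : Relation.EqvGen (Edge I J) u (c 0) := Quotient.exact (mem_classOf.1 hu)
      have key : ∀ a b, Relation.EqvGen (Edge I J) a b →
          ((∃ y < s, c y = a) ↔ ∃ y < s, c y = b) := by
        intro a b hab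
        induction hab with
        | rel a b h =>
          constructor
          · rintro ⟨y, hy, rfl⟩
            exact hout y hy b h
          · rintro ⟨y, hy, rfl⟩
            exact hin y hy a h
        | refl a => exact Iff.rfl
        | symm a b _ ih => exact ih.symm
        | trans a b c _ _ ih1 ih2 => exact ih1.trans ih2
      exact (key _ _ h).2 ⟨0, hs, rfl⟩
    · rintro ⟨y, hy, rfl⟩
      induction y with
      | zero => simp
      | succ y ih => exact (mem_classOf_of_edge (hstep y hy)).1 (ih (by omega))
  have himage : classOf (⟦c 0⟧ : Quotient (edgeSetoid I J)) = (Finset.range s).image c := by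
    ext u
    simp [hmem u]
  have hcard : (classOf (⟦c 0⟧ : Quotient (edgeSetoid I J))).card = s := by
    rw [himage, Finset.card_image_of_injOn, Finset.card_range]
    intro x hx y hy h
    exact hinj x (by simpa using hx) y (by simpa using hy) h
  refine ⟨hmem, hcard, Equiv.ofBijective
    (fun x => ⟨c x, (hmem _).2 ⟨x, by omega, rfl⟩⟩) ⟨?_, ?_⟩, fun x => rfl⟩
  · intro x y h
    exact Fin.ext (hinj x (by omega) y (by omega) (congrArg Subtype.val h))
  · rintro ⟨u, hu⟩
    obtain ⟨y, hy, rfl⟩ := (hmem u).1 hu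
    exact ⟨⟨y, by omega⟩, rfl⟩

theorem edge_iff {w : Perm (Fin n)} (hw : ∀ p, w (I p) = J p) {u v : Fin n} :
    Edge I J u v ↔ u ∈ Set.range I ∧ w u = v := by
  constructor
  · rintro ⟨p, rfl, rfl⟩
    exact ⟨⟨p, rfl⟩, hw p⟩
  · rintro ⟨⟨p, rfl⟩, rfl⟩
    exact ⟨p, rfl, (hw p).symm⟩

theorem exists_pow_eq_self (w : Perm (Fin n)) (a : Fin n) : ∃ s, 0 < s ∧ (w ^ s) a = a :=
  ⟨orderOf w, orderOf_pos w, by rw [pow_orderOf_eq_one]; rfl⟩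

-- Extend `(I, J)` to a permutation `w` and walk back from `e` along `w⁻¹` until the next vertex
-- outside the range of `I`. The vertices before that one form the path ending in `e`.
variable (I J) in
theorem path_of_notMem_range {e : Fin n} (he : e ∉ Set.range I) :
    IsDirectedPath I J (classOf (⟦e⟧ : Quotient (edgeSetoid I J))) ∧
      ∀ u ∈ classOf (⟦e⟧ : Quotient (edgeSetoid I J)), u ∉ Set.range I → u = e := by
  classical
  obtain ⟨w, hw⟩ := Perm.exists_extending_pair I J I.injective J.injective
  have hex : ∃ s, 0 < s ∧ (w⁻¹ ^ s) e ∉ Set.range I := by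
    obtain ⟨s, hs, h⟩ := exists_pow_eq_self w⁻¹ e
    exact ⟨s, hs, by rwa [h]⟩
  obtain ⟨hs, hsI⟩ := Nat.find_spec hex
  have hmin := fun x => Nat.find_min hex (m := x)
  set s := Nat.find hex
  set a := (w⁻¹ ^ (s - 1)) e with ha
  have hcx : ∀ x, x + 1 ≤ s → (w ^ x) a = (w⁻¹ ^ (s - 1 - x)) e := by
    intro x hx
    rw [ha, ← Perm.mul_apply]
    congr 1
    rw [show s - 1 = x + (s - 1 - x) by omega, pow_add, ← mul_assoc, ← (Commute.inv_right
      (Commute.refl w)).mul_pow, mul_inv_cancel, one_pow, one_mul]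
    congr 1
    omega
  have hrange : ∀ x < s, ((w ^ x) a ∈ Set.range I ↔ x + 1 < s) := by
    intro x hx
    rw [hcx x hx]
    constructor
    · intro h
      by_contra hlt
      rw [show s - 1 - x = 0 by omega] at h
      exact he h
    · intro h
      by_contra h'
      exact hmin (s - 1 - x) (by omega) ⟨by omega, h'⟩
  have hlast : (w ^ (s - 1)) a = e := by
    rw [hcx _ (by omega), Nat.sub_self, pow_zero, Perm.one_apply]
  -- So no edge enters the first vertex `a`.
  have hprev : w⁻¹ a ∉ Set.range I := by
    rw [ha, ← Perm.mul_apply, ← pow_succ', Nat.sub_add_cancel hs]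
    exact hsI
  have hsucc : ∀ x, w ((w ^ x) a) = (w ^ (x + 1)) a := fun x => by
    rw [pow_succ', Perm.mul_apply]
  -- A repetition, moved forward to the end, would put `e` at an earlier place, whose vertex lies in
  -- the range of `I`.
  have hinj' : ∀ x y, x < y → y < s → (w ^ x) a ≠ (w ^ y) a := by
    intro x y hxy hy h
    have h1 : (w ^ (s - 1 - y)) ((w ^ x) a) = e := by
      rw [h, ← Perm.mul_apply, ← pow_add, ← hlast]
      congr 2
      omega
    rw [← Perm.mul_apply, ← pow_add] at h1
    exact he (h1 ▸ (hrange _ (by omega)).2 (by omega))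
  have hinj : ∀ x < s, ∀ y < s, (w ^ x) a = (w ^ y) a → x = y := by
    intro x hx y hy h
    rcases lt_trichotomy x y with hlt | heq | hlt
    · exact (hinj' x y hlt hy h).elim
    · exact heq
    · exact (hinj' y x hlt hx h.symm).elim
  have key := exists_enumeration (I := I) (J := J) (c := fun x => (w ^ x) a) hs
    hinj (fun x hx => (edge_iff hw).2 ⟨(hrange x (by omega)).2 hx, hsucc x⟩)
    (fun x hx u hu => by
      obtain ⟨h1, rfl⟩ := (edge_iff hw).1 hu
      exact ⟨x + 1, (hrange x hx).1 h1, (hsucc x).symm⟩)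
    (fun x hx u hu => by
      obtain ⟨h1, h2⟩ := (edge_iff hw).1 hu
      cases x with
      | zero =>
        refine (hprev ?_).elim
        rw [← Perm.eq_inv_iff_eq] at h2
        simpa [h2] using h1
      | succ x =>
        refine ⟨x, by omega, w.injective ?_⟩
        rw [hsucc, h2])
  have hclass : (⟦(w ^ 0) a⟧ : Quotient (edgeSetoid I J)) = ⟦e⟧ :=
    (mem_classOf.1 ((key.1 e).2 ⟨s - 1, by omega, hlast⟩)).symm
  rw [hclass] at key
  obtain ⟨hmem, hcard, v, hv⟩ := key
  refine ⟨⟨v, fun x y => ?_⟩, ?_⟩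
  · have hx : (x : ℕ) < s := by omega
    have hy : (y : ℕ) < s := by omega
    rw [hv, hv, edge_iff hw, hrange x hx, hsucc]
    constructor
    · rintro ⟨h1, h2⟩
      exact (hinj _ h1 _ hy h2).symm
    · intro h
      exact ⟨by omega, by rw [h]⟩
  · intro u hu huI
    obtain ⟨y, hy, rfl⟩ := (hmem u).1 hu
    have : ¬ y + 1 < s := fun h => huI ((hrange y hy).2 h)
    rw [show y = s - 1 by omega, hlast]

/-- On such a class the edges are exactly the steps of a permutation `w` extending `(I, J)`, so the
class is a `w`-orbit and `s` its period. -/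
theorem cycle_of_subset_range {q : Quotient (edgeSetoid I J)}
    (hq : ∀ u ∈ classOf q, u ∈ Set.range I) : IsDirectedCycle I J (classOf q) := by
  classical
  obtain ⟨w, hw⟩ := Perm.exists_extending_pair I J I.injective J.injective
  induction q using Quotient.inductionOn with
  | h a =>
  have hex := exists_pow_eq_self w a
  obtain ⟨hs, hsa⟩ := Nat.find_spec hex
  have hmin := fun x => Nat.find_min hex (m := x)
  set s := Nat.find hex
  have hsucc : ∀ x, w ((w ^ x) a) = (w ^ (x + 1)) a := fun x => by
    rw [pow_succ', Perm.mul_apply]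
  have hrange : ∀ x, (w ^ x) a ∈ classOf (⟦a⟧ : Quotient (edgeSetoid I J)) := by
    intro x
    induction x with
    | zero => simp
    | succ x ih => exact (mem_classOf_of_edge ((edge_iff hw).2 ⟨hq _ ih, hsucc x⟩)).1 ih
  have hmod : ∀ x, (w ^ x) a = (w ^ (x % s)) a := by
    intro x
    have hfix : ∀ m, ((w ^ s) ^ m) a = a := fun m => by
      induction m with
      | zero => rfl
      | succ m ih => rw [pow_succ, Perm.mul_apply, hsa, ih]
    conv_lhs => rw [← Nat.mod_add_div x s, pow_add, Perm.mul_apply, pow_mul, hfix]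
  have hinj' : ∀ x y, x < y → y < s → (w ^ x) a ≠ (w ^ y) a := by
    intro x y hxy hy h
    rw [show y = x + (y - x) by omega, pow_add, Perm.mul_apply] at h
    exact hmin (y - x) (by omega) ⟨by omega, ((w ^ x).injective h).symm⟩
  have hinj : ∀ x < s, ∀ y < s, (w ^ x) a = (w ^ y) a → x = y := by
    intro x hx y hy h
    rcases lt_trichotomy x y with hlt | heq | hlt
    · exact (hinj' x y hlt hy h).elim
    · exact heq
    · exact (hinj' y x hlt hx h.symm).elim
  have key := exists_enumeration (I := I) (J := J) (c := fun x => (w ^ x) a) hs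
    hinj (fun x hx => (edge_iff hw).2 ⟨hq _ (hrange x), hsucc x⟩)
    (fun x hx u hu => by
      obtain ⟨-, rfl⟩ := (edge_iff hw).1 hu
      exact ⟨(x + 1) % s, Nat.mod_lt _ hs, by rw [hsucc]; exact (hmod _).symm⟩)
    (fun x hx u hu => by
      obtain ⟨-, h2⟩ := (edge_iff hw).1 hu
      cases x with
      | zero =>
        refine ⟨s - 1, by omega, w.injective ?_⟩
        rw [hsucc, Nat.sub_add_cancel hs, hsa, h2]
        rfl
      | succ x =>
        refine ⟨x, by omega, w.injective ?_⟩
        rw [hsucc, h2])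
  have hclass : (⟦(w ^ 0) a⟧ : Quotient (edgeSetoid I J)) = ⟦a⟧ := rfl
  rw [hclass] at key
  obtain ⟨-, hcard, v, hv⟩ := key
  refine ⟨v, fun x y => ?_⟩
  have hx : (x : ℕ) < s := by omega
  have hy : (y : ℕ) < s := by omega
  rw [hv, hv, edge_iff hw, hsucc, hmod (x + 1),
    show ((x : ℕ) + 1) % _ = _ from congrArg (((x : ℕ) + 1) % ·) hcard]
  constructor
  · rintro ⟨-, h2⟩
    exact (hinj _ (Nat.mod_lt _ hs) _ hy h2).symm
  · intro h
    exact ⟨hq _ (hrange x), by rw [h]⟩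

/-- The last vertex of a path has no outgoing edge. With `isDirectedCycle_iff` this makes paths and
cycles complementary among the components. -/
theorem isDirectedPath_iff (q : Quotient (edgeSetoid I J)) :
    IsDirectedPath I J (classOf q) ↔ ∃ u ∈ classOf q, u ∉ Set.range I := by
  constructor
  · rintro ⟨v, hv⟩
    have hpos : 0 < (classOf q).card := by
      induction q using Quotient.inductionOn with
      | h a => exact Finset.card_pos.2 ⟨a, by simp⟩
    set x : Fin (classOf q).card := ⟨(classOf q).card - 1, by omega⟩
    refine ⟨v x, (v x).2, ?_⟩
    rintro ⟨p, hp⟩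
    have hedge : Edge I J (v x) (J p) := ⟨p, hp, rfl⟩
    have hJ := (mem_classOf_of_edge hedge).1 (v x).2
    have h := (hv x (v.symm ⟨J p, hJ⟩)).1 (by simpa using hedge)
    have := (v.symm ⟨J p, hJ⟩).2
    simp only [x] at h
    omega
  · rintro ⟨u, hu, huI⟩
    rw [← mem_classOf.1 hu]
    exact (path_of_notMem_range I J huI).1

theorem isDirectedCycle_iff (q : Quotient (edgeSetoid I J)) :
    IsDirectedCycle I J (classOf q) ↔ ¬ ∃ u ∈ classOf q, u ∉ Set.range I := by
  constructor
  · rintro ⟨v, hv⟩ ⟨u, hu, huI⟩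
    have hpos : 0 < (classOf q).card := Finset.card_pos.2 ⟨u, hu⟩
    set x := v.symm ⟨u, hu⟩ with hx
    obtain ⟨p, hp, -⟩ := (hv x ⟨((x : ℕ) + 1) % (classOf q).card, Nat.mod_lt _ hpos⟩).2 rfl
    rw [hx, Equiv.apply_symm_apply] at hp
    exact huI ⟨p, hp⟩
  · intro h
    push Not at h
    exact cycle_of_subset_range h

/-- A class that is a path. -/
def IsPathClass (q : Quotient (edgeSetoid I J)) : Prop := ∃ u ∈ classOf q, u ∉ Set.range I

open Classical in
theorem sizes_eq {P : Finset (Fin n) → Prop} {Q : Quotient (edgeSetoid I J) → Prop}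
    [Fintype {q // Q q}]
    (h : ∀ q, P (classOf q) ↔ Q q) :
    ((components I J).filter P).val.map Finset.card =
      (Finset.univ : Finset {q // Q q}).val.map fun q => (classOf q.1).card := by
  have h1 : (components I J).filter P = (Finset.univ.filter Q).map ⟨classOf, classOf_injective⟩ := by
    ext C
    simp only [components_eq, Finset.mem_filter, Finset.mem_image, Finset.mem_univ, true_and,
      Finset.mem_map, Function.Embedding.coeFn_mk]
    constructor
    · rintro ⟨⟨q, rfl⟩, hP⟩
      exact ⟨q, (h q).1 hP, rfl⟩
    · rintro ⟨q, hq, rfl⟩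
      exact ⟨⟨q, rfl⟩, (h q).2 hq⟩
  have h2 : Finset.univ.filter Q = (Finset.univ : Finset {q // Q q}).map
      (Function.Embedding.subtype Q) := by
    ext q
    simp
  rw [h1, h2, Finset.map_val, Finset.map_val, Multiset.map_map, Multiset.map_map]
  rfl

open Classical in
variable (I J) in
theorem pathType_eq : pathType I J =
    (Finset.univ : Finset {q : Quotient (edgeSetoid I J) // IsPathClass q}).val.map
      fun q => (classOf q.1).card :=
  sizes_eq isDirectedPath_iff

open Classical in
variable (I J) in
theorem cycleType_eq : cycleType I J =
    (Finset.univ : Finset {q : Quotient (edgeSetoid I J) // ¬ IsPathClass q}).val.map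
      fun q => (classOf q.1).card :=
  sizes_eq isDirectedCycle_iff

theorem const_on_classes_iff {κ : Type*} (g : Fin n → κ) :
    (∀ x y, (edgeSetoid I J) x y → g x = g y) ↔ ∀ p, g (I p) = g (J p) := by
  constructor
  · exact fun h p => h _ _ (.rel _ _ ⟨p, rfl, rfl⟩)
  · intro h x y hxy
    induction hxy with
    | rel x y hxy =>
      obtain ⟨p, rfl, rfl⟩ := hxy
      exact h p
    | refl x => rfl
    | symm x y _ ih => exact ih.symm
    | trans x y z _ _ ih1 ih2 => exact ih1.trans ih2

-- Each path has exactly one vertex outside the range of `I`, its end, and cycles have none.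
open Classical in
theorem card_ends {κ : Type*} [DecidableEq κ] (h : Quotient (edgeSetoid I J) → κ) (v : κ) :
    (Finset.univ.filter fun x => x ∉ Set.range I ∧ h ⟦x⟧ = v).card =
      (Finset.univ.filter fun q : {q : Quotient (edgeSetoid I J) // IsPathClass q} =>
        h q.1 = v).card := by
  refine Finset.card_bij (fun x hx => ⟨⟦x⟧, x, by simp, (Finset.mem_filter.1 hx).2.1⟩) ?_ ?_ ?_
  · intro x hx
    simpa using (Finset.mem_filter.1 hx).2.2
  · intro x hx y hy hxy
    have h1 : (⟦x⟧ : Quotient (edgeSetoid I J)) = ⟦y⟧ := congrArg Subtype.val hxy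
    exact (path_of_notMem_range I J (Finset.mem_filter.1 hy).2.1).2 x (mem_classOf.2 h1)
      (Finset.mem_filter.1 hx).2.1
  · rintro ⟨q, u, hu, huI⟩ hq
    have := mem_classOf.1 hu
    subst this
    exact ⟨u, Finset.mem_filter.2 ⟨Finset.mem_univ _, huI, by simpa using hq⟩, rfl⟩

end Components

/-! ### The permutations that extend a partial permutation -/

section Enumerator

variable {ι κ : Type*} [Fintype ι] [DecidableEq ι] [Fintype κ] [DecidableEq κ]

theorem colorSum_univ (m : ι → ℕ) : colorSum m Finset.univ (Finset.univ : Finset κ) =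
    ∑ f : ι → κ, (∏ v, ((Finset.univ.filter fun s => f s = v).card.factorial : MvPolynomial κ ℂ)) *
      ∏ s, MvPolynomial.X (f s) ^ m s := by
  symm
  refine Finset.sum_bij (fun f _ s => some (f s)) ?_ ?_ ?_ ?_
  · intro f _
    simp [mem_colorings]
  · intro f _ f' _ h
    funext s
    exact Option.some_injective _ (congrFun h s)
  · intro f hf
    choose f' _ hf' using fun s => (mem_colorings.1 hf).1 s (Finset.mem_univ s)
    exact ⟨f', Finset.mem_univ _, funext fun s => (hf' s).symm⟩
  · intro f _
    simp [colorWeight]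

theorem rename_colorSum_univ (m : ι → ℕ) (w : Perm κ) :
    MvPolynomial.rename w (colorSum m Finset.univ (Finset.univ : Finset κ)) =
      colorSum m Finset.univ Finset.univ := by
  rw [rename_colorSum, Finset.map_univ_equiv]

-- Double counting of pairs of an extension `w` and a `w`-invariant coloring. The factorials see
-- only the colors of the paths, so the cycles split off as power sums.
open Classical in
theorem sum_extensions {n k : ℕ} (I J : Fin k ↪ Fin n) :
    ∑ w : Perm (Fin n) with ∀ p, w (I p) = J p,
        (w.partition.parts.map (MvPolynomial.psum κ ℂ)).prod =
      colorSum (fun q : {q : Quotient (edgeSetoid I J) // IsPathClass q} => (classOf q.1).card)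
          Finset.univ Finset.univ *
        ∏ q : {q : Quotient (edgeSetoid I J) // ¬ IsPathClass q},
          MvPolynomial.psum κ ℂ (classOf q.1).card := by
  have h1 : ∑ w : Perm (Fin n) with ∀ p, w (I p) = J p,
        (w.partition.parts.map (MvPolynomial.psum κ ℂ)).prod =
      ∑ g : Fin n → κ with ∀ x y, (edgeSetoid I J) x y → g x = g y,
        (∏ v, ((Finset.univ.filter fun x => x ∉ Set.range I ∧ g x = v).card.factorial :
          MvPolynomial κ ℂ)) * ∏ x, MvPolynomial.X (g x) := by
    simp_rw [prod_psum_partition, const_on_classes_iff]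
    rw [Finset.sum_congr rfl fun w _ => Finset.sum_filter _ _, Finset.sum_comm, Finset.sum_filter]
    refine Finset.sum_congr rfl fun g _ => ?_
    rw [← Finset.sum_filter, Finset.filter_filter, Finset.sum_const, nsmul_eq_mul]
    split_ifs with hg
    · rw [← Nat.cast_prod]
      congr 2
      convert card_perm_extending I J hg
    -- A coloring that changes along an edge is invariant under no extension.
    · rw [Finset.card_eq_zero.2, Nat.cast_zero, zero_mul]
      refine Finset.filter_eq_empty_iff.2 ?_
      rintro w - ⟨hw, hgw⟩
      exact hg fun p => by rw [← hw, ← congrFun hgw (I p)]; rfl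
  have h2 := sum_const_on_classes (r := edgeSetoid I J) fun g : Fin n → κ =>
    (∏ v, ((Finset.univ.filter fun x => x ∉ Set.range I ∧ g x = v).card.factorial :
      MvPolynomial κ ℂ)) * ∏ x, MvPolynomial.X (g x)
  refine h1.trans (Eq.trans (by congr!) (h2.trans ?_))
  simp_rw [prod_X_comp_mk, card_ends]
  rw [colorSum_univ]
  simp_rw [MvPolynomial.psum]
  rw [Finset.prod_univ_sum, Fintype.piFinset_univ, Finset.sum_mul_sum, ← Finset.sum_product',
    Finset.univ_product_univ]
  refine Fintype.sum_equiv (Equiv.piEquivPiSubtypeProd IsPathClass fun _ => κ) _ _ fun h => ?_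
  rw [mul_assoc]
  congr 1
  exact (Fintype.prod_subtype_mul_prod_subtype IsPathClass
    fun q => (MvPolynomial.X (h q) : MvPolynomial κ ℂ) ^ (classOf q).card).symm

end Enumerator

/-! ### Partitions and Young diagrams -/

theorem card_eq_sum_rowLens (Y : YoungDiagram) : Y.card = Y.rowLens.sum := by
  rw [card_eq_sum_rowLen (N := Y.colLen 0), Fin.sum_univ_eq_sum_range]
  · rfl
  · intro i hi
    by_contra h
    have := YoungDiagram.mem_iff_lt_colLen.1
      (YoungDiagram.mem_iff_lt_rowLen.2 (Nat.pos_of_ne_zero h))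
    omega

section Partition

variable {n : ℕ} (lam : n.Partition)

theorem rowLens_diagram : (diagram lam).rowLens = partList lam :=
  YoungDiagram.rowLens_ofRowLens_eq_self fun _ hx =>
    lam.parts_pos ((Multiset.mem_sort _).1 hx)

theorem coe_partList : (partList lam : Multiset ℕ) = lam.parts := Multiset.sort_eq _ _

theorem card_diagram : (diagram lam).card = n := by
  rw [card_eq_sum_rowLens, rowLens_diagram, ← Multiset.sum_coe, coe_partList, lam.parts_sum]

theorem rowLen_diagram : (diagram lam).rowLen = part lam := by
  funext i
  refine eq_of_forall_lt_iff fun j => ?_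
  have h : (i, j) ∈ diagram lam ↔ ∃ h : i < (partList lam).length, j < (partList lam)[i] :=
    YoungDiagram.mem_ofRowLens
  rw [← YoungDiagram.mem_iff_lt_rowLen, h, part]
  by_cases hi : i < (partList lam).length
  · simp [hi]
  · simp [hi]

theorem diagram_injective : Function.Injective (diagram : n.Partition → YoungDiagram) := by
  intro lam lam' h
  ext1
  rw [← coe_partList, ← coe_partList, ← rowLens_diagram, ← rowLens_diagram, h]

theorem exists_diagram_eq {Y : YoungDiagram} (hY : Y.card = n) :
    ∃ lam : n.Partition, diagram lam = Y := by
  refine ⟨⟨Y.rowLens, fun {x} hx => Y.pos_of_mem_rowLens x hx, ?_⟩, ?_⟩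
  · rw [Multiset.sum_coe, ← card_eq_sum_rowLens, hY]
  · have : partList (⟨Y.rowLens, fun {x} hx => Y.pos_of_mem_rowLens x hx, by
        rw [Multiset.sum_coe, ← card_eq_sum_rowLens, hY]⟩ : n.Partition) = Y.rowLens := by
      refine List.Perm.eq_of_pairwise' (r := (· ≥ ·)) (Multiset.pairwise_sort _ _)
        Y.rowLens_sorted.pairwise ?_
      exact Multiset.coe_eq_coe.1 (Multiset.sort_eq _ _)
    simp only [diagram, this]
    exact YoungDiagram.ofRowLens_to_rowLens_eq_self

theorem sum_diagramsLE {R : Type*} [AddCommMonoid R] {N : ℕ} (hn : n ≤ N) (F : YoungDiagram → R)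
    (hF : ∀ Y, Y.card ≠ n → F Y = 0) :
    ∑ Y ∈ diagramsLE N, F Y = ∑ lam : n.Partition, F (diagram lam) := by
  symm
  refine Finset.sum_of_injOn diagram diagram_injective.injOn ?_ ?_ fun _ _ => rfl
  · intro lam _
    simpa [card_diagram] using hn
  · intro Y _ hY
    refine hF Y fun h => hY ?_
    obtain ⟨lam, rfl⟩ := exists_diagram_eq h
    exact ⟨lam, by simp, rfl⟩

end Partition

theorem card_last_eq {r : ℕ} (c : Fin (r + 1) → YoungDiagram)
    (hc : ∀ i : Fin r, c i.castSucc ≤ c i.succ) :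
    (c (Fin.last r)).card = (c 0).card + (chainType c).sum := by
  induction r with
  | zero => simp [chainType]
  | succ r ih =>
    rw [← Fin.cons_self_tail c, chainType_cons, List.sum_cons, Fin.cons_zero, ← add_assoc]
    have h0 : (Fin.tail c 0).card = (c 0).card + ((Fin.tail c 0).cells \ (c 0).cells).card :=
      card_eq_add_of_le (hc 0)
    rw [← h0]
    exact ih (Fin.tail c) fun i => hc i.succ

theorem RibbonTableau.card_eq {Y Z : YoungDiagram} {r : ℕ} (T : RibbonTableau Y Z r) :
    Z.card = Y.card + (chainType T.chain).sum := by
  have := card_last_eq T.chain T.chain_le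
  rwa [T.chain_last, T.chain_zero] at this

theorem RibbonTableau.isMonotonic_iff_tailsBelow {Y Z : YoungDiagram} {r N : ℕ}
    (T : RibbonTableau Y Z r) (hZ : Z.card ≤ N) : T.IsMonotonic ↔ TailsBelow N T.chain := by
  rw [T.isMonotonic_iff]
  refine ⟨fun h => ⟨h, fun i => ?_⟩, fun h => h.1⟩
  exact tailRow_lt (T.chain_le i) (T.isRibbon i) ((Finset.card_le_card
    (YoungDiagram.cells_subset_iff.2 (T.chain_le_shape _))).trans hZ)

/-! ### The expansion in finitely many variables -/

theorem firstVars_self (N : ℕ) : firstVars N N = Finset.univ := by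
  ext j
  simp [firstVars]

open Classical in
theorem antisymm_mul_colorSum_mul_psum_prod {ι : Type*} [Fintype ι] [DecidableEq ι] {n N a b : ℕ}
    (hab : a + b = n) (hn : n ≤ N) (m : ι → ℕ) (μ : a.Partition) (ν : b.Partition)
    (hm : Finset.univ.val.map m = μ.parts) :
    antisymm (xpow (expVec N ⊥) * (colorSum m Finset.univ Finset.univ *
        (ν.parts.map (MvPolynomial.psum (Fin N) ℂ)).prod)) =
      multFactorial μ • ∑ lam : n.Partition,
        (∑ ρ : a.Partition, pathChar ρ μ * skewChar lam ρ ν) •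
          antisymm (xpow (expVec N (diagram lam))) := by
  have hparts : ∀ s, m s ∈ μ.parts := fun s => by
    rw [← hm]
    exact Multiset.mem_map_of_mem m (Finset.mem_univ_val s)
  have hsymm : ∀ w : Perm (Fin N), MvPolynomial.rename w
      (ν.parts.map (MvPolynomial.psum (Fin N) ℂ)).prod =
        (ν.parts.map (MvPolynomial.psum (Fin N) ℂ)).prod := by
    intro w
    rw [map_multiset_prod, Multiset.map_map]
    congr 2
    funext e
    exact MvPolynomial.psum_isSymmetric (Fin N) ℂ e w
  have hsum : ∑ s, m s = a := by
    rw [← μ.parts_sum, ← hm]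
    rfl
  have hcard : (Finset.univ : Finset ι).card = μ.parts.card := by
    rw [← hm, Multiset.card_map]
    rfl
  have hpath := antisymm_mul_colorSum (N := N) m (fun s => μ.parts_pos (hparts s)) μ.parts.card
    Finset.univ hcard N le_rfl ⊥ (by
      rw [hsum, YoungDiagram.card, YoungDiagram.cells_bot, Finset.card_empty]
      omega)
  rw [firstVars_self, hm] at hpath
  rw [sum_diagramsLE (n := a) (N := N) (by omega)] at hpath
  swap
  · intro Z hZ
    rw [Finset.sum_eq_zero, zero_smul]
    intro T _
    refine if_neg fun h => hZ ?_
    rw [T.card_eq, YoungDiagram.card, YoungDiagram.cells_bot, Finset.card_empty, zero_add,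
      ← Multiset.sum_coe, h.2, μ.parts_sum]
  have hpathChar : ∀ ρ : a.Partition, (∑ T : RibbonTableau ⊥ (diagram ρ) μ.parts.card,
      if TailsBelow N T.chain ∧ (chainType T.chain : Multiset ℕ) = μ.parts
        then chainSign T.chain else 0) = pathChar ρ μ := by
    intro ρ
    refine Finset.sum_congr rfl fun T _ => if_congr ?_ rfl rfl
    rw [T.isMonotonic_iff_tailsBelow (N := N) (by rw [card_diagram]; omega)]
    rfl
  simp_rw [hpathChar] at hpath
  rw [← mul_assoc, antisymm_mul_of_rename_eq _ _ hsymm, hpath, smul_mul_assoc, Finset.sum_mul]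
  congr 1
  have hskew : ∀ ρ : a.Partition, antisymm (xpow (expVec N (diagram ρ))) *
      (ν.parts.map (MvPolynomial.psum (Fin N) ℂ)).prod =
        ∑ lam : n.Partition, skewChar lam ρ ν • antisymm (xpow (expVec N (diagram lam))) := by
    intro ρ
    have hνsum : (partList ν).sum = b := by
      rw [← Multiset.sum_coe, coe_partList, ν.parts_sum]
    have h := antisymm_mul_psum_prod (N := N) (partList ν)
      (fun d hd => ν.parts_pos ((Multiset.mem_sort _).1 hd)) (diagram ρ)
      (by rw [card_diagram, hνsum]; omega)
    rw [sum_diagramsLE hn] at h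
    · rw [← antisymm_mul_of_rename_eq _ _ hsymm, ← coe_partList, Multiset.map_coe,
        Multiset.prod_coe, h]
      rfl
    · intro Z hZ
      rw [Finset.sum_eq_zero, zero_smul]
      intro T _
      refine if_neg fun h => hZ ?_
      rw [T.card_eq, card_diagram, h, hνsum, hab]
  simp_rw [smul_mul_assoc, hskew, Finset.smul_sum, smul_smul, Finset.sum_smul]
  exact Finset.sum_comm

/-! ### Alternants and truncation -/

theorem alternant_eq_rename (N : ℕ) (β : ℕ → ℕ) : alternant N β =
    MvPolynomial.rename Fin.val (antisymm (xpow fun j : Fin N => β j + (N - 1 - j))) := by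
  rw [antisymm_apply, map_sum, alternant]
  refine Finset.sum_congr rfl fun w _ => ?_
  rw [map_zsmul]
  simp [xpow]

theorem alternant_part {n : ℕ} (N : ℕ) (lam : n.Partition) : alternant N (part lam) =
    MvPolynomial.rename Fin.val (antisymm (xpow (expVec N (diagram lam)))) := by
  rw [alternant_eq_rename]
  simp only [← rowLen_diagram]
  rfl

theorem alternant_zero (N : ℕ) : alternant N 0 =
    MvPolynomial.rename Fin.val (antisymm (xpow (expVec N ⊥))) := by
  rw [alternant_eq_rename]
  congr 3
  funext j
  rw [expVec, rowLen_eq_zero (by simp [YoungDiagram.card])]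
  rfl

theorem alternant_zero_ne_zero (N : ℕ) : alternant N 0 ≠ 0 := by
  have h0 : alternant N 0 = (Perm.sign (Fin.revPerm : Perm (Fin N)) : MvPolynomial ℕ ℂ) *
      (Matrix.vandermonde fun i : Fin N => (MvPolynomial.X (i : ℕ) : MvPolynomial ℕ ℂ)).det := by
    rw [← Matrix.det_permute', alternant_eq_det]
    congr 1
    ext1 i j
    simp [Matrix.vandermonde, Fin.val_rev, Nat.sub_sub, Nat.add_comm]
  rw [h0]
  refine mul_ne_zero ?_ (Matrix.det_vandermonde_ne_zero_iff.2 fun i j h => ?_)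
  · rcases Int.units_eq_one_or (Perm.sign (Fin.revPerm : Perm (Fin N))) with h | h <;> simp [h]
  · exact Fin.ext (MvPolynomial.X_injective h)

theorem alternant_mul_schurPoly {n : ℕ} (N : ℕ) (lam : n.Partition) :
    alternant N 0 * schurPoly N lam = alternant N (part lam) :=
  (alternant_dvd N (part lam)).choose_spec.symm

/-- The polynomial `P` in `N` variables arises from the power series `f` by setting the other
variables to `0`. -/
def IsTruncation (N : ℕ) (f : MvPowerSeries ℕ ℂ) (P : MvPolynomial (Fin N) ℂ) : Prop :=
  ∀ m : ℕ →₀ ℕ, (∀ i ∈ m.support, i < N) →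
    MvPowerSeries.coeff m f = MvPolynomial.coeff m (MvPolynomial.rename Fin.val P)

namespace IsTruncation

variable {N : ℕ}

theorem one : IsTruncation N 1 1 := by
  classical
  intro m _
  rw [map_one (MvPolynomial.rename _), MvPowerSeries.coeff_one, MvPolynomial.coeff_one]
  simp only [eq_comm]

theorem mul {f g : MvPowerSeries ℕ ℂ} {P Q : MvPolynomial (Fin N) ℂ} (hf : IsTruncation N f P)
    (hg : IsTruncation N g Q) : IsTruncation N (f * g) (P * Q) := by
  classical
  intro m hm
  rw [map_mul (MvPolynomial.rename _), MvPowerSeries.coeff_mul, MvPolynomial.coeff_mul]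
  refine Finset.sum_congr rfl fun x hx => ?_
  rw [Finset.HasAntidiagonal.mem_antidiagonal] at hx
  rw [hf x.1 fun i hi => hm i ?_, hg x.2 fun i hi => hm i ?_]
  all_goals
    rw [← hx]
    simp only [Finsupp.mem_support_iff, Finsupp.add_apply] at hi ⊢
    omega

/-- Positivity of `d` keeps the monomials `xᵢ ^ d` distinct, so that all coefficients are `0` or
`1`. -/
theorem powerSum {d : ℕ} (hd : 0 < d) :
    IsTruncation N (powerSum d) (MvPolynomial.psum (Fin N) ℂ d) := by
  classical
  intro m hm
  change AtomicSymm.powerSum d m = _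
  rw [AtomicSymm.powerSum, MvPolynomial.psum, map_sum, MvPolynomial.coeff_sum]
  simp only [map_pow, MvPolynomial.rename_X, MvPolynomial.coeff_X_pow]
  split_ifs with h
  · obtain ⟨i, rfl⟩ := h
    have hi : i < N := hm i (by simp [hd.ne'])
    rw [Finset.sum_eq_single (⟨i, hi⟩ : Fin N), if_pos rfl]
    · intro j _ hj
      refine if_neg fun h => hj (Fin.ext ?_)
      exact Finsupp.single_left_injective hd.ne' h
    · simp
  · rw [Finset.sum_eq_zero]
    intro j _
    exact if_neg fun h' => h ⟨j, h'.symm⟩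

theorem powerSumProd {M : Multiset ℕ} (hM : ∀ d ∈ M, 0 < d) :
    IsTruncation N (powerSumProd M) (M.map (MvPolynomial.psum (Fin N) ℂ)).prod := by
  induction M using Multiset.induction_on with
  | empty => simpa [AtomicSymm.powerSumProd] using one
  | cons d M ih =>
    rw [AtomicSymm.powerSumProd, Multiset.map_cons, Multiset.prod_cons, Multiset.map_cons,
      Multiset.prod_cons]
    exact (powerSum (hM d (Multiset.mem_cons_self d M))).mul
      (ih fun e he => hM e (Multiset.mem_cons_of_mem he))

end IsTruncation

/-! ### The atomic function as a sum over extensions, and its Schur expansion in `N` variables -/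

open Classical in
theorem atomic_eq {n k : ℕ} (I J : Fin k ↪ Fin n) : atomic I J =
    ∑ w : Perm (Fin n) with ∀ p, w (I p) = J p, powerSumProd w.partition.parts := by
  have hn : (n.factorial : ℂ) ≠ 0 := Nat.cast_ne_zero.2 n.factorial_ne_zero
  have hcard : Fintype.card (Perm (Fin n)) = n.factorial := by
    rw [Fintype.card_perm, Fintype.card_fin]
  -- All `n!` conjugates contribute the same sum, which cancels the normalization of the average.
  have hconj : ∀ v : Perm (Fin n),
      ∑ w : Perm (Fin n), indicator I J (v⁻¹ * w * v) • powerSumProd w.partition.parts =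
        ∑ w : Perm (Fin n), indicator I J w • powerSumProd w.partition.parts := by
    intro v
    refine Fintype.sum_equiv (MulAut.conj v⁻¹).toEquiv _ _ fun w => ?_
    have h : (MulAut.conj v⁻¹).toEquiv w = v⁻¹ * w * v := by simp
    rw [h, Perm.partition_eq_of_isConj.1 (isConj_iff.2 ⟨v⁻¹, by rw [inv_inv]⟩ :
      IsConj w (v⁻¹ * w * v))]
  rw [atomic, frobenius, smul_smul, mul_inv_cancel₀ hn, one_smul]
  simp only [reynolds, mul_smul, Finset.sum_smul]
  rw [← Finset.smul_sum, Finset.sum_comm, Finset.sum_congr rfl fun v _ => hconj v,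
    Finset.sum_const, Finset.card_univ, hcard,
    ← Nat.cast_smul_eq_nsmul ℂ, smul_smul, inv_mul_cancel₀ hn, one_smul, Finset.sum_filter]
  refine Finset.sum_congr rfl fun w _ => ?_
  rw [indicator]
  split_ifs <;> simp

open Classical in
theorem rename_sum_extensions {n k N a b : ℕ} {I J : Fin k ↪ Fin n} {μ : a.Partition}
    {ν : b.Partition} (hn : n ≤ N) (hμ : pathType I J = μ.parts) (hν : cycleType I J = ν.parts) :
    MvPolynomial.rename Fin.val (∑ w : Perm (Fin n) with ∀ p, w (I p) = J p,
        (w.partition.parts.map (MvPolynomial.psum (Fin N) ℂ)).prod) =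
      (multFactorial μ : ℂ) • ∑ lam : n.Partition,
        ((∑ ρ : a.Partition, pathChar ρ μ * skewChar lam ρ ν : ℤ) : ℂ) • schurPoly N lam := by
  rw [pathType_eq] at hμ
  rw [cycleType_eq] at hν
  -- Every vertex lies in exactly one component, and every component is a path or a cycle.
  have hab : a + b = n := by
    have h := Fintype.sum_subtype_add_sum_subtype (IsPathClass (I := I) (J := J))
      fun q => (classOf q).card
    have ha : ∑ q : {q : Quotient (edgeSetoid I J) // IsPathClass q}, (classOf q.1).card = a := by
      rw [← μ.parts_sum, ← hμ]
      rfl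
    have hb : ∑ q : {q : Quotient (edgeSetoid I J) // ¬ IsPathClass q},
        (classOf q.1).card = b := by
      rw [← ν.parts_sum, ← hν]
      rfl
    rw [ha, hb] at h
    rw [h]
    have := Finset.card_eq_sum_card_fiberwise (s := (Finset.univ : Finset (Fin n)))
      (t := Finset.univ) (f := fun x => (⟦x⟧ : Quotient (edgeSetoid I J))) (by simp)
    rw [Finset.card_univ, Fintype.card_fin] at this
    exact this.symm
  have hprod : ∏ q : {q : Quotient (edgeSetoid I J) // ¬ IsPathClass q},
      MvPolynomial.psum (Fin N) ℂ (classOf q.1).card =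
        (ν.parts.map (MvPolynomial.psum (Fin N) ℂ)).prod := by
    rw [← hν, Multiset.map_map]
    rfl
  -- Multiplication by the denominator of the bialternant formula turns Schur polynomials into
  -- alternants.
  apply mul_left_cancel₀ (alternant_zero_ne_zero N)
  rw [sum_extensions, hprod, mul_smul_comm, Finset.mul_sum]
  simp_rw [mul_smul_comm, alternant_mul_schurPoly, alternant_part]
  rw [alternant_zero, ← map_mul, ← antisymm_mul_of_rename_eq,
    antisymm_mul_colorSum_mul_psum_prod hab hn _ μ ν hμ, Nat.cast_smul_eq_nsmul, map_nsmul, map_sum]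
  · simp_rw [Int.cast_smul_eq_zsmul, map_zsmul]
  · intro w
    rw [map_mul, rename_colorSum_univ, map_multiset_prod, Multiset.map_map]
    congr 3
    funext e
    exact MvPolynomial.psum_isSymmetric (Fin N) ℂ e w

end

end AtomicSymm

/-! ### The identity of formal power series -/

theorem mainTheorem5 (n k : ℕ) (I J : Fin k ↪ Fin n) (a b : ℕ)
    (μ : a.Partition) (ν : b.Partition)
    (hμ : AtomicSymm.pathType I J = μ.parts) (hν : AtomicSymm.cycleType I J = ν.parts) :
    AtomicSymm.atomic I J =
      (AtomicSymm.multFactorial μ : ℂ) • ∑ lam : n.Partition,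
        ((∑ ρ : a.Partition, AtomicSymm.pathChar ρ μ * AtomicSymm.skewChar lam ρ ν : ℤ) : ℂ) •
          AtomicSymm.schur lam := by
  classical
  ext m
  -- This is the number of variables that `schur` uses for the coefficient of `m`, so the Schur side
  -- agrees by definition; it also exceeds every index in `m`, as truncation requires.
  have hpoly := congrArg (MvPolynomial.coeff m) (AtomicSymm.rename_sum_extensions
    (le_max_left n (m.support.sup id + 1)) hμ hν)
  rw [map_sum, MvPolynomial.coeff_sum, MvPolynomial.coeff_smul, MvPolynomial.coeff_sum] at hpoly
  rw [AtomicSymm.atomic_eq, map_sum, map_smul, map_sum]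
  refine Eq.trans (Finset.sum_congr rfl fun w _ => ?_) (hpoly.trans ?_)
  · refine AtomicSymm.IsTruncation.powerSumProd (fun d hd => w.partition.parts_pos hd) m
      fun i hi => ?_
    exact (Nat.lt_succ_of_le (Finset.le_sup (f := id) hi)).trans_le (le_max_right _ _)
  · congr 1
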